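/- Let $g(u;a)=u(1-u)(u-a)$ and consider the lattice Nagumo equation \[ \dot u_i(t)=d\,\bigl(u_{i-1}(t)-2u_i(t)+u_{i+1}(t)\bigr)+g(u_i(t);a),\qquad i\in\mathbb Z . \] A stationary solution is a real double sequence $u=(u_i)_{i\in\mathbb Z}$ at which the right-hand side vanishes for every $i$; it is $n$-periodic if $u_{i+n}=u_i$ for all $i$, and a primitive $n$-periodic solution if, in addition, it has no positive period smaller than $n$. It is asymptotically stable if it is Lyapunov stable and locally attracting for the equation posed as an evolution equation on $\ell^\infty(\mathbb Z;\mathbb R)$, with respect to the $\ell^\infty$-norm. Two sequences are equivalent with respect to translations if one is obtained from the other by some $\mathcal T_\ell$, $(\mathcal T_\ell u)_i=u_{i+\ell}$, $\ell\in\mathbb Z$; they are equivalent with respect to translations and reflections if one is obtained from the other by composing maps $\mathcal T_\ell$ and $\mathcal R$, $(\mathcal R u)_i=u_{1-i}$. With $\varphi$ Euler's totient function and $\mu$ the Möbius function, put \[ N_k(n)=\frac1n\sum_{m\mid n}\varphi(m)k^{n/m},\qquad L_k(n)=\frac1n\sum_{m\mid n}\mu(m)k^{n/m}, \] \[ B_k(n)=\begin{cases}\frac12\bigl(N_k(n)+\frac{k+1}{2}k^{n/2}\bigr)&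 n\text{ even},\\[2pt] \frac12\bigl(N_k(n)+k^{(n+1)/2}\bigr)& n\text{ odd},\end{cases}\qquad BL_k(n)=\sum_{m\mid n}\mu(m)B_k(n/m). \] Theorem. Let $n\ge 2$ be an integer and $a\in(0,1)$. Then there is $d_0>0$ such that for every $d\in(0,d_0)$ the lattice Nagumo equation has exactly 1. $3^n$ $n$-periodic stationary solutions. These form (a) $N_3(n)$ equivalence classes with respect to translations, of which $L_3(n)$ are formed by primitive $n$-periodic solutions; and (b) $B_3(n)$ equivalence classes with respect to translations and reflections, of which $BL_3(n)$ are formed by primitive $n$-periodic solutions. 2. $2^n$ asymptotically stable $n$-periodic stationary solutions. These form (a) $N_2(n)$ equivalence classes with respect to translations, of which $L_2(n)$ are formed by primitive $n$-periodic solutions; and (b) $B_2(n)$ equivalence classes with respect to translations and reflections, of which $BL_2(n)$ are formed by primitive $n$-periodic solutions. -/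

import Mathlib

open scoped ENNReal

namespace Nagumo

/-- The cubic bistable nonlinearity `g(u; a) = u (1 - u) (u - a)`. -/
def g (a u : ℝ) : ℝ := u * (1 - u) * (u - a)

/-- The right-hand side of the lattice Nagumo equation, on an arbitrary double sequence:
`d (u_{i-1} - 2 u_i + u_{i+1}) + g(u_i; a)`. -/
def rhs (a d : ℝ) (u : ℤ → ℝ) (i : ℤ) : ℝ :=
  d * (u (i - 1) - 2 * u i + u (i + 1)) + g a (u i)

/-- The space `ℓ^∞(ℤ; ℝ)` with the supremum norm. -/
abbrev LInf : Type := lp (fun _ : ℤ => ℝ) ∞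

/-- The right-hand side of the lattice equation maps bounded sequences to bounded sequences. -/
theorem memℓp_rhs (a d : ℝ) (u : LInf) : Memℓp (E := fun _ : ℤ => ℝ) (rhs a d u) ∞ := by
  have hu : ∀ i, |u i| ≤ ‖u‖ := fun i => lp.norm_apply_le_norm ENNReal.top_ne_zero u i
  have hM : 0 ≤ ‖u‖ := norm_nonneg u
  refine memℓp_infty ⟨|d| * (‖u‖ + 2 * ‖u‖ + ‖u‖) + ‖u‖ * (1 + ‖u‖) * (‖u‖ + |a|), ?_⟩
  rintro _ ⟨i, rfl⟩
  have h1 : |u (i - 1) - 2 * u i + u (i + 1)| ≤ ‖u‖ + 2 * ‖u‖ + ‖u‖ := by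
    have e1 := abs_le.1 (hu (i - 1))
    have e2 := abs_le.1 (hu i)
    have e3 := abs_le.1 (hu (i + 1))
    exact abs_le.2 ⟨by linarith, by linarith⟩
  have h2 : |1 - u i| ≤ 1 + ‖u‖ := by
    have e2 := abs_le.1 (hu i)
    exact abs_le.2 ⟨by linarith, by linarith⟩
  have h3 : |u i - a| ≤ ‖u‖ + |a| := (abs_sub _ _).trans (by linarith [hu i])
  change |d * (u (i - 1) - 2 * u i + u (i + 1)) + u i * (1 - u i) * (u i - a)| ≤ _
  refine (abs_add_le _ _).trans ?_
  rw [abs_mul, abs_mul, abs_mul]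
  have := hu i
  gcongr

/-- The right-hand side of the lattice equation as a vector field on `ℓ^∞(ℤ; ℝ)`. -/
def field (a d : ℝ) (u : LInf) : LInf := ⟨rhs a d u, memℓp_rhs a d u⟩

/-- `u` solves `u' = F(u)` on `[0, ∞)` (with the one-sided derivative at `0`). -/
def IsForwardSolution {E : Type*} [NormedAddCommGroup E] [NormedSpace ℝ E]
    (F : E → E) (u : ℝ → E) : Prop :=
  ∀ t : ℝ, 0 ≤ t → HasDerivWithinAt u (F (u t)) (Set.Ici 0) t

/-- Asymptotic stability of `x` for `u' = F(u)` in the norm of `E`. All initial values near `x`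
have a solution on `[0, ∞)`; solutions that start close enough to `x` stay as close to `x`
as prescribed (first part), and they converge to `x` as `t → ∞` (second part). -/
def IsAsymptoticallyStable {E : Type*} [NormedAddCommGroup E] [NormedSpace ℝ E]
    (F : E → E) (x : E) : Prop :=
  (∀ ε : ℝ, 0 < ε → ∃ δ : ℝ, 0 < δ ∧ ∀ x₀ : E, ‖x₀ - x‖ < δ →
    (∃ u : ℝ → E, IsForwardSolution F u ∧ u 0 = x₀) ∧
    ∀ u : ℝ → E, IsForwardSolution F u → u 0 = x₀ → ∀ t : ℝ, 0 ≤ t → ‖u t - x‖ < ε) ∧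
  (∃ γ : ℝ, 0 < γ ∧ ∀ x₀ : E, ‖x₀ - x‖ < γ →
    (∃ u : ℝ → E, IsForwardSolution F u ∧ u 0 = x₀) ∧
    ∀ u : ℝ → E, IsForwardSolution F u → u 0 = x₀ → Filter.Tendsto u Filter.atTop (nhds x))

/-- The `n`-periodic stationary solutions of the lattice Nagumo equation
(`n` need not be the least period). -/
def periodicStationary (n : ℕ) (a d : ℝ) : Set (ℤ → ℝ) :=
  {u | (∀ i, rhs a d u i = 0) ∧ ∀ i, u (i + n) = u i}

/-- The `n`-periodic stationary solutions that are asymptotically stable for the lattice equation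
with respect to the `ℓ^∞`-norm (all small bounded perturbations, periodic or not). -/
def stablePeriodicStationary (n : ℕ) (a d : ℝ) : Set (ℤ → ℝ) :=
  {u | u ∈ periodicStationary n a d ∧
    ∃ x : LInf, (∀ i, x i = u i) ∧ IsAsymptoticallyStable (field a d) x}

/-- The primitive elements of a set of `n`-periodic sequences:
those with no positive period smaller than `n`. -/
def primitivePart (n : ℕ) (S : Set (ℤ → ℝ)) : Set (ℤ → ℝ) :=
  {u | u ∈ S ∧ ∀ m : ℕ, 0 < m → m < n → ¬ ∀ i, u (i + m) = u i}

/-- Translation `(T_ℓ u)_i = u_{i+ℓ}`. -/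
def translate (l : ℤ) (u : ℤ → ℝ) : ℤ → ℝ := fun i => u (i + l)

/-- Reflection `(R u)_i = u_{1-i}`. -/
def reflect (u : ℤ → ℝ) : ℤ → ℝ := fun i => u (1 - i)

/-- Equivalence of double sequences with respect to translations. -/
def translationSetoid : Setoid (ℤ → ℝ) where
  r u v := ∃ l : ℤ, v = translate l u
  iseqv := by
    refine ⟨fun u => ⟨0, ?_⟩, ?_, ?_⟩
    · funext i; simp [translate]
    · rintro u _ ⟨l, rfl⟩
      exact ⟨-l, by funext i; simp [translate]⟩
    · rintro u _ _ ⟨l, rfl⟩ ⟨m, rfl⟩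
      exact ⟨m + l, by funext i; simp [translate, add_assoc]⟩

/-- Equivalence of double sequences with respect to translations and reflections. -/
def translationReflectionSetoid : Setoid (ℤ → ℝ) where
  r u v := ∃ l : ℤ, v = translate l u ∨ v = translate l (reflect u)
  iseqv := by
    refine ⟨fun u => ⟨0, Or.inl ?_⟩, ?_, ?_⟩
    · funext i; simp [translate]
    · rintro u _ ⟨l, rfl | rfl⟩
      · exact ⟨-l, Or.inl (by funext i; simp [translate])⟩
      · refine ⟨l, Or.inr ?_⟩
        funext i; simp only [translate, reflect]; congr 1; ring
    · rintro u _ _ ⟨l, rfl | rfl⟩ ⟨m, rfl | rfl⟩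
      · exact ⟨m + l, Or.inl (by funext i; simp [translate, add_assoc])⟩
      · refine ⟨m - l, Or.inr ?_⟩
        funext i; simp only [translate, reflect]; congr 1; ring
      · exact ⟨m + l, Or.inr (by funext i; simp [translate, add_assoc])⟩
      · refine ⟨m - l, Or.inl ?_⟩
        funext i; simp only [translate, reflect]; congr 1; ring

/-- The set of equivalence classes formed by the elements of `S`. -/
def classes (r : Setoid (ℤ → ℝ)) (S : Set (ℤ → ℝ)) : Set (Quotient r) :=
  Quotient.mk r '' S

/-- `N_k(n) = (1/n) ∑_{d ∣ n} φ(d) k^{n/d}`. -/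
def N (k n : ℕ) : ℚ :=
  1 / (n : ℚ) * ∑ d ∈ n.divisors, (Nat.totient d : ℚ) * (k : ℚ) ^ (n / d)

/-- `L_k(n) = (1/n) ∑_{d ∣ n} μ(d) k^{n/d}`. -/
def L (k n : ℕ) : ℚ :=
  1 / (n : ℚ) * ∑ d ∈ n.divisors, (ArithmeticFunction.moebius d : ℚ) * (k : ℚ) ^ (n / d)

/-- `B_k(n) = (N_k(n) + ((k+1)/2) k^{n/2}) / 2` for even `n`, and
`B_k(n) = (N_k(n) + k^{(n+1)/2}) / 2` for odd `n`. -/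
def B (k n : ℕ) : ℚ :=
  if Even n then 1 / 2 * (N k n + ((k : ℚ) + 1) / 2 * (k : ℚ) ^ (n / 2))
  else 1 / 2 * (N k n + (k : ℚ) ^ ((n + 1) / 2))

/-- `BL_k(n) = ∑_{d ∣ n} μ(d) B_k(n/d)`. -/
def BL (k n : ℕ) : ℚ :=
  ∑ d ∈ n.divisors, (ArithmeticFunction.moebius d : ℚ) * B k (n / d)

end Nagumo

/-! ### Periodic words and transport of class counts. -/

namespace Nagumo

/-! At `d = 0` the sites decouple, and the stationary solutions are the sequences with letters in
`{0, a, 1}`, all simple zeros of `g`. For small `d` each periodic word persists: a simplified Newton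
map, with the slope frozen at the letters, is a contraction near the word (`newton_sub_newton_le`),
which gives `exists_stationary_near` and `stationary_unique`. Conversely, a periodic stationary
solution lies in `[0, 1]` by the maximum principle, so `|g(u_i)| ≤ 2d`, and every `u_i` is close to
a letter (`exists_word_near`).

Uniqueness makes this bijection commute with translations and reflections, so all counts reduce to
counts of words (`HasWordCounts.of_equivariant`). For words, Burnside's lemma for the cyclic and
dihedral groups gives `N` and `B`, and Möbius inversion over the least period gives `L` and `BL`.

The stable solutions are those whose word avoids `a`. At `0` and `1` the slope of `g` is negative
and dominates, so the sup-norm distance decays exponentially (`contracting_step_field`). If some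
letter is `a`, a solution starting at `x + η` stays above `x` by comparison, and its coordinate at
that site never decreases, so it cannot return to `x` (`not_isAsymptoticallyStable_field`). -/

theorem ncard_image_mk_congr {α β : Type*} (r : Setoid α) (q : Setoid β) {S : Set α} {T : Set β}
    {e : α → β} (he : Set.BijOn e S T) (h : ∀ x ∈ S, ∀ y ∈ S, r x y ↔ q (e x) (e y)) :
    (Quotient.mk r '' S).ncard = (Quotient.mk q '' T).ncard := by
  have key : ∀ c ∈ Quotient.mk r '' S, ∃ x ∈ S, Quotient.mk r x = c := fun c hc => hc
  choose f hfS hf using key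
  refine Set.ncard_congr (fun c hc => Quotient.mk q (e (f c hc))) ?_ ?_ ?_
  · intro c hc
    exact ⟨_, he.mapsTo (hfS c hc), rfl⟩
  · intro c c' hc hc' hcc
    have := (h _ (hfS c hc) _ (hfS c' hc')).2 (Quotient.exact hcc)
    rw [← hf c hc, ← hf c' hc']
    exact Quotient.sound this
  · rintro _ ⟨y, hy, rfl⟩
    obtain ⟨x, hx, rfl⟩ := he.surjOn hy
    refine ⟨Quotient.mk r x, ⟨x, hx, rfl⟩, Quotient.sound ?_⟩
    exact (h _ (hfS _ _) _ hx).1 (Quotient.exact (hf _ ⟨x, hx, rfl⟩))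

/-- The `n`-periodic double sequences with values in `A`. -/
def periodicWords (A : Finset ℝ) (n : ℕ) : Set (ℤ → ℝ) :=
  {u | (∀ i, u i ∈ A) ∧ ∀ i, u (i + n) = u i}

/-- The periodic double sequence determined by a word on `ZMod n`. -/
def unroll {A : Finset ℝ} {n : ℕ} (f : ZMod n → A) : ℤ → ℝ := fun i => f (i : ZMod n)

theorem eq_of_intCast_eq {α : Type*} {n : ℕ} {u : ℤ → α} (hu : ∀ i, u (i + n) = u i) {i j : ℤ}
    (h : (i : ZMod n) = j) : u i = u j := by
  obtain ⟨k, hk⟩ := (ZMod.intCast_eq_intCast_iff_dvd_sub i j n).1 h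
  have hp : Function.Periodic u (n : ℤ) := hu
  have := hp.int_mul k i
  rw [← this]
  congr 1
  rw [Int.cast_id, mul_comm, ← hk]
  ring

theorem exists_zmod_of_periodic {α : Type*} {n : ℕ} {u : ℤ → α} (hu : ∀ i, u (i + n) = u i) :
    ∃ f : ZMod n → α, ∀ i : ℤ, f i = u i := by
  choose s hs using ZMod.intCast_surjective (n := n)
  exact ⟨fun x => u (s x), fun i => eq_of_intCast_eq hu (hs _)⟩

theorem bijOn_unroll (A : Finset ℝ) (n : ℕ) :
    Set.BijOn (unroll (A := A) (n := n)) Set.univ (periodicWords A n) := by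
  refine ⟨fun f _ => ⟨fun i => (f i).2, fun i => ?_⟩, fun f _ g _ h => ?_, fun u hu => ?_⟩
  · simp [unroll]
  · funext x
    obtain ⟨i, rfl⟩ := ZMod.intCast_surjective x
    exact Subtype.ext (congrFun h i)
  · obtain ⟨f, hf⟩ := exists_zmod_of_periodic (u := fun i => (⟨u i, hu.1 i⟩ : A)) (n := n)
      (fun i => Subtype.ext (hu.2 i))
    exact ⟨f, trivial, funext fun i => congrArg Subtype.val (hf i)⟩

theorem ncard_periodicWords (A : Finset ℝ) {n : ℕ} (hn : n ≠ 0) :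
    (periodicWords A n).ncard = A.card ^ n := by
  have : NeZero n := ⟨hn⟩
  rw [← (bijOn_unroll A n).image_eq, (bijOn_unroll A n).injOn.ncard_image,
    Set.ncard_univ]
  simp [Nat.card_eq_fintype_card, ZMod.card]

theorem finite_periodicWords (A : Finset ℝ) {n : ℕ} (hn : n ≠ 0) :
    (periodicWords A n).Finite := by
  have : NeZero n := ⟨hn⟩
  rw [← (bijOn_unroll A n).image_eq]
  exact Set.finite_univ.image _

/-! ### Burnside counting -/

/-- The action of the cyclic group on words by translation. -/
instance cyclicAction (n : ℕ) (α : Type*) : MulAction (Multiplicative (ZMod n)) (ZMod n → α) where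
  smul j f := fun x => f (x + j.toAdd)
  one_smul f := by funext x; exact congrArg f (add_zero x)
  mul_smul i j f := by
    funext x
    exact congrArg f (by simp only [toAdd_mul]; ring)

theorem cyclic_smul_apply {n : ℕ} {α : Type*} (j : Multiplicative (ZMod n)) (f : ZMod n → α)
    (x : ZMod n) : (j • f) x = f (x + j.toAdd) := rfl

/-- The action of the dihedral group on words by translations and reflections. -/
instance dihedralAction (n : ℕ) (α : Type*) : MulAction (DihedralGroup n) (ZMod n → α) where
  smul
    | .r j, f => fun x => f (x + j)
    | .sr j, f => fun x => f (j - x)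
  one_smul f := by
    funext x
    exact congrArg f (add_zero x)
  mul_smul g h f := by
    funext x
    rcases g with i | i <;> rcases h with j | j
    · exact congrArg f (show x + (i + j) = x + i + j by ring)
    · exact congrArg f (show j - i - x = j - (x + i) by ring)
    · exact congrArg f (show i + j - x = i - x + j by ring)
    · exact congrArg f (show x + (j - i) = j - (i - x) by ring)

theorem dihedral_r_smul_apply {n : ℕ} {α : Type*} (j : ZMod n) (f : ZMod n → α)
    (x : ZMod n) : (DihedralGroup.r j • f) x = f (x + j) := rfl

theorem dihedral_sr_smul_apply {n : ℕ} {α : Type*} (j : ZMod n) (f : ZMod n → α)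
    (x : ZMod n) : (DihedralGroup.sr j • f) x = f (j - x) := rfl

/-- Invariant words are the functions on the quotient by the subgroup generated by `j`, which has `n
/ addOrderOf j` elements. -/
theorem card_translation_invariant {n : ℕ} [NeZero n] (α : Type*) [Fintype α] (j : ZMod n) :
    Nat.card {f : ZMod n → α // ∀ x, f (x + j) = f x}
      = Fintype.card α ^ (n / addOrderOf j) := by
  let H := AddSubgroup.zmultiples j
  have e : {f : ZMod n → α // ∀ x, f (x + j) = f x} ≃ (ZMod n ⧸ H → α) :=
    { toFun := fun f => fun q => Quotient.liftOn' q f.1 (by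
        intro x y hxy
        rw [QuotientAddGroup.leftRel_apply] at hxy
        obtain ⟨k, hk⟩ := AddSubgroup.mem_zmultiples_iff.1 hxy
        have hp : Function.Periodic f.1 j := f.2
        have := hp.zsmul k x
        rw [← this, hk, add_neg_cancel_left])
      invFun := fun φ => ⟨fun x => φ (QuotientAddGroup.mk x), fun x => by
        refine congrArg φ ?_
        rw [QuotientAddGroup.eq]
        simp only [neg_add_rev, neg_add_cancel_right]
        exact H.neg_mem (AddSubgroup.mem_zmultiples j)⟩
      left_inv := fun f => rfl
      right_inv := fun φ => by
        funext q
        induction q using Quotient.inductionOn'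
        rfl }
  rw [Nat.card_congr e, Nat.card_fun, Nat.card_eq_fintype_card (α := α)]
  congr 1
  have h := AddSubgroup.card_eq_card_quotient_mul_card_addSubgroup H
  rw [Nat.card_zmultiples, Nat.card_zmod] at h
  rw [eq_comm]
  exact Nat.div_eq_of_eq_mul_left (addOrderOf_pos j) h

/-- Each orbit of `σ` is represented by its smaller point, where the value can be prescribed freely.
The order serves only to choose representatives. -/
theorem card_invariant_eq_pow_card_le {ι : Type*} [Fintype ι] [LinearOrder ι] (α : Type*) [Fintype α]
    {σ : ι → ι} (hσ : Function.Involutive σ) :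
    Nat.card {f : ι → α // ∀ x, f (σ x) = f x} = Fintype.card α ^ (Nat.card {x // x ≤ σ x}) := by
  have e : {f : ι → α // ∀ x, f (σ x) = f x} ≃ ({x // x ≤ σ x} → α) :=
    { toFun := fun f x => f.1 x.1
      invFun := fun φ => ⟨fun x => if h : x ≤ σ x then φ ⟨x, h⟩ else
          φ ⟨σ x, by rw [hσ x]; exact (not_le.1 h).le⟩, by
        intro x
        rcases lt_trichotomy x (σ x) with h | h | h
        · simp [hσ x, h.le, h.not_ge]
        · simp [← h]
        · simp [hσ x, h.le, h.not_ge]⟩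
      left_inv := fun f => by
        ext x
        dsimp only
        split_ifs
        · rfl
        · exact f.2 x
      right_inv := fun φ => by
        funext x
        simp [x.2] }
  rw [Nat.card_congr e, Nat.card_fun, Nat.card_eq_fintype_card (α := α)]

/-- `σ` exchanges `{x ≤ σ x}` and `{σ x ≤ x}`; these cover everything and meet in the fixed points.
-/
theorem two_mul_card_le_involution {ι : Type*} [Fintype ι] [LinearOrder ι]
    {σ : ι → ι} (hσ : Function.Involutive σ) :
    2 * Nat.card {x // x ≤ σ x} = Fintype.card ι + Nat.card {x // σ x = x} := by
  classical
  simp only [Nat.card_eq_fintype_card, Fintype.card_subtype]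
  have h1 : (Finset.univ.filter fun x => x ≤ σ x).card
      = (Finset.univ.filter fun x => σ x ≤ x).card := by
    refine Finset.card_bij (fun x _ => σ x) ?_ (fun x _ y _ h => hσ.injective h) ?_
    · intro x hx
      simpa [hσ x] using hx
    · intro y hy
      exact ⟨σ y, by simpa [hσ y] using hy, hσ y⟩
  have h2 := Finset.card_union_add_card_inter (Finset.univ.filter fun x => x ≤ σ x)
    (Finset.univ.filter fun x => σ x ≤ x)
  have h3 : (Finset.univ.filter fun x => x ≤ σ x) ∪ (Finset.univ.filter fun x => σ x ≤ x)
      = Finset.univ := by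
    ext x; simp [le_total]
  have h4 : (Finset.univ.filter fun x => x ≤ σ x) ∩ (Finset.univ.filter fun x => σ x ≤ x)
      = Finset.univ.filter fun x => σ x = x := by
    ext x; simp [le_antisymm_iff, and_comm]
  rw [h3, h4, Finset.card_univ] at h2
  omega

/-- A cyclic group of order `n` has `φ(m)` elements of each order `m` dividing `n`. -/
theorem sum_pow_div_addOrderOf (k n : ℕ) [NeZero n] :
    ∑ j : ZMod n, k ^ (n / addOrderOf j) = ∑ m ∈ n.divisors, m.totient * k ^ (n / m) := by
  classical
  have hmaps : ∀ j ∈ (Finset.univ : Finset (ZMod n)), addOrderOf j ∈ n.divisors := fun j _ =>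
    Nat.mem_divisors.2 ⟨by simpa [ZMod.card] using addOrderOf_dvd_card (x := j), NeZero.ne n⟩
  rw [← Finset.sum_fiberwise_of_maps_to hmaps]
  refine Finset.sum_congr rfl fun m hm => ?_
  rw [Finset.sum_congr rfl (g := fun _ => k ^ (n / m))
    (fun j hj => by rw [(Finset.mem_filter.1 hj).2]), Finset.sum_const, smul_eq_mul]
  congr 1
  exact IsAddCyclic.card_addOrderOf_eq_totient (by rw [ZMod.card]; exact Nat.dvd_of_mem_divisors hm)

end Nagumo

/-! ### Words fixed by reflections, and the orbit counts. -/

namespace Nagumo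

theorem card_involution_invariant {ι : Type*} [Fintype ι] (α : Type*) [Fintype α]
    {σ : ι → ι} (hσ : Function.Involutive σ) :
    Nat.card {f : ι → α // ∀ x, f (σ x) = f x}
      = Fintype.card α ^ ((Fintype.card ι + Nat.card {x // σ x = x}) / 2) := by
  let _ : LinearOrder ι := LinearOrder.lift' (Fintype.equivFin ι) (Fintype.equivFin ι).injective
  rw [card_invariant_eq_pow_card_le α hσ, ← two_mul_card_le_involution hσ,
    Nat.mul_div_cancel_left _ two_pos]

theorem card_half_odd {m : ℕ} (j : ZMod (2 * m + 1)) : Nat.card {x // j - x = x} = 1 := by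
  rw [Nat.card_eq_one_iff_unique]
  have h : (2 * m + 2 : ZMod (2 * m + 1)) = 1 := by
    have := ZMod.natCast_self (2 * m + 1)
    push_cast at this
    linear_combination this
  -- `m + 1` is the inverse of `2` modulo `2 * m + 1`.
  refine ⟨⟨fun x y => Subtype.ext ?_⟩, ⟨⟨(m + 1) * j, ?_⟩⟩⟩
  · have hx := x.2
    have hy := y.2
    linear_combination (-x.1 + y.1) * h + (m + 1) * (-hx + hy)
  · linear_combination - j * h

/-- Parity is well defined modulo `2 * m`, so `2x = j` needs `j` even; then `j = 2t` has the two
solutions `t` and `t + m`. -/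
theorem card_half_even {m : ℕ} (hm : m ≠ 0) (j : ZMod (2 * m)) :
    Nat.card {x // j - x = x} = if Even j.val then 2 else 0 := by
  have : NeZero (2 * m) := ⟨by omega⟩
  have hself : (2 * m : ZMod (2 * m)) = 0 := by
    have := ZMod.natCast_self (2 * m)
    push_cast at this
    exact this
  have hj : (j.val : ZMod (2 * m)) = j := ZMod.natCast_zmod_val j
  split_ifs with h
  · obtain ⟨t, ht⟩ := h
    rw [ht] at hj
    push_cast at hj
    have hS : {x : ZMod (2 * m) | j - x = x} = {(t : ZMod (2 * m)), (t + m : ZMod (2 * m))} := by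
      ext x
      simp only [Set.mem_ofPred_eq, Set.mem_insert_iff, Set.mem_singleton_iff]
      constructor
      · intro hx
        have h2 : ((2 * ((x.val : ℤ) - t) : ℤ) : ZMod (2 * m)) = 0 := by
          push_cast
          rw [ZMod.natCast_zmod_val]
          linear_combination -hx - hj
        rw [ZMod.intCast_zmod_eq_zero_iff_dvd] at h2
        obtain ⟨c, hc⟩ := h2
        push_cast at hc
        have hc' : (x.val : ℤ) = t + m * c := by linarith
        have hxc : x = t + m * (c : ZMod (2 * m)) := by
          rw [← ZMod.natCast_zmod_val x]
          exact_mod_cast congrArg (Int.cast : ℤ → ZMod (2 * m)) hc'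
        rcases Int.even_or_odd' c with ⟨e, he | he⟩
        · left
          rw [hxc, he]
          push_cast
          linear_combination (e : ZMod (2 * m)) * hself
        · right
          rw [hxc, he]
          push_cast
          linear_combination (e : ZMod (2 * m)) * hself
      · rintro (rfl | rfl)
        · linear_combination -hj
        · linear_combination -hj - hself
    have hne : (t : ZMod (2 * m)) ≠ t + m := by
      intro h
      have h0 : ((m : ℕ) : ZMod (2 * m)) = 0 := by linear_combination -h
      rw [ZMod.natCast_eq_zero_iff] at h0
      have := Nat.le_of_dvd (Nat.pos_of_ne_zero hm) h0
      omega
    change Nat.card ({x : ZMod (2 * m) | j - x = x} : Set (ZMod (2 * m))) = 2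
    rw [hS, Nat.card_coe_set_eq, Set.ncard_pair hne]
  · rw [Nat.card_eq_zero]
    left
    refine ⟨fun ⟨x, hx⟩ => h ?_⟩
    have h2 : (((j.val : ℤ) - 2 * x.val : ℤ) : ZMod (2 * m)) = 0 := by
      push_cast
      rw [ZMod.natCast_zmod_val, ZMod.natCast_zmod_val]
      linear_combination hx
    rw [ZMod.intCast_zmod_eq_zero_iff_dvd] at h2
    obtain ⟨c, hc⟩ := h2
    push_cast at hc
    have : Even (j.val : ℤ) := ⟨x.val + m * c, by linear_combination hc⟩
    exact_mod_cast this

theorem sum_zmod_val {n : ℕ} [NeZero n] (F : ℕ → ℕ) :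
    ∑ j : ZMod n, F j.val = ∑ i ∈ Finset.range n, F i := by
  obtain ⟨n, rfl⟩ := Nat.exists_eq_succ_of_ne_zero (NeZero.ne n)
  exact Fin.sum_univ_eq_sum_range F (n + 1)

theorem sum_range_parity (p q m : ℕ) :
    ∑ i ∈ Finset.range (2 * m), (if Even i then p else q) = m * (p + q) := by
  induction m with
  | zero => simp
  | succ m ih =>
    rw [show 2 * (m + 1) = 2 * m + 1 + 1 by ring, Finset.sum_range_succ, Finset.sum_range_succ, ih]
    simp
    ring

theorem sum_card_reflection_invariant_odd (α : Type*) [Fintype α] (m : ℕ) :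
    ∑ j : ZMod (2 * m + 1), Nat.card {f : ZMod (2 * m + 1) → α // ∀ x, f (j - x) = f x}
      = (2 * m + 1) * Fintype.card α ^ (m + 1) := by
  rw [Finset.sum_congr rfl (g := fun _ => Fintype.card α ^ (m + 1))]
  · simp [ZMod.card]
  · intro j _
    rw [card_involution_invariant α (fun x => by ring), card_half_odd, ZMod.card]
    congr 1
    omega

/-- Half of the reflections fix two positions and have `m + 1` orbits; the other half fix none and
have `m` orbits. -/
theorem sum_card_reflection_invariant_even (α : Type*) [Fintype α] {m : ℕ} (hm : m ≠ 0) :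
    haveI : NeZero (2 * m) := ⟨by omega⟩
    ∑ j : ZMod (2 * m), Nat.card {f : ZMod (2 * m) → α // ∀ x, f (j - x) = f x}
      = m * (Fintype.card α ^ (m + 1) + Fintype.card α ^ m) := by
  have : NeZero (2 * m) := ⟨by omega⟩
  rw [← sum_range_parity, ← sum_zmod_val]
  refine Finset.sum_congr rfl fun j _ => ?_
  rw [card_involution_invariant α (fun x => by ring), card_half_even hm, ZMod.card]
  split_ifs <;> congr 1 <;> omega

theorem card_cyclic_orbits (α : Type*) [Fintype α] (n : ℕ) [NeZero n] :
    Nat.card (Quotient (MulAction.orbitRel (Multiplicative (ZMod n)) (ZMod n → α))) * n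
      = ∑ m ∈ n.divisors, m.totient * Fintype.card α ^ (n / m) := by
  classical
  have h := MulAction.sum_card_fixedBy_eq_card_orbits_mul_card_group
    (Multiplicative (ZMod n)) (ZMod n → α)
  rw [Fintype.card_multiplicative, ZMod.card] at h
  rw [Nat.card_eq_fintype_card, ← h, ← sum_pow_div_addOrderOf]
  refine Fintype.sum_equiv Multiplicative.toAdd _ _ fun j => ?_
  rw [← card_translation_invariant, ← Nat.card_eq_fintype_card]
  exact Nat.card_congr (Equiv.subtypeEquivRight fun f => funext_iff)

theorem card_dihedral_orbits (α : Type*) [Fintype α] (n : ℕ) [NeZero n] :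
    Nat.card (Quotient (MulAction.orbitRel (DihedralGroup n) (ZMod n → α))) * (2 * n)
      = ∑ m ∈ n.divisors, m.totient * Fintype.card α ^ (n / m)
        + ∑ j : ZMod n, Nat.card {f : ZMod n → α // ∀ x, f (j - x) = f x} := by
  classical
  have h := MulAction.sum_card_fixedBy_eq_card_orbits_mul_card_group
    (DihedralGroup n) (ZMod n → α)
  rw [DihedralGroup.card] at h
  rw [Nat.card_eq_fintype_card, ← h, ← sum_pow_div_addOrderOf,
    ← Equiv.sum_comp DihedralGroup.equivSum.symm, Fintype.sum_sum_type]
  congr 1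
  · refine Finset.sum_congr rfl fun j _ => ?_
    rw [← card_translation_invariant, ← Nat.card_eq_fintype_card]
    exact Nat.card_congr (Equiv.subtypeEquivRight fun f => funext_iff)
  · refine Finset.sum_congr rfl fun j _ => ?_
    rw [← Nat.card_eq_fintype_card]
    exact Nat.card_congr (Equiv.subtypeEquivRight fun f => funext_iff)

theorem translationSetoid_unroll_iff {A : Finset ℝ} {n : ℕ} (f g : ZMod n → A) :
    MulAction.orbitRel (Multiplicative (ZMod n)) (ZMod n → A) f g
      ↔ translationSetoid (unroll f) (unroll g) := by
  rw [Setoid.comm' (MulAction.orbitRel (Multiplicative (ZMod n)) (ZMod n → A))]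
  constructor
  · rintro ⟨j, rfl⟩
    obtain ⟨l, hl⟩ := ZMod.intCast_surjective j.toAdd
    refine ⟨l, funext fun i => ?_⟩
    simp [unroll, translate, cyclic_smul_apply, hl]
  · rintro ⟨l, hl⟩
    refine ⟨Multiplicative.ofAdd (l : ZMod n), (bijOn_unroll A n).injOn trivial trivial ?_⟩
    rw [hl]
    funext i
    simp [unroll, translate, cyclic_smul_apply]

theorem translationReflectionSetoid_unroll_iff {A : Finset ℝ} {n : ℕ} (f g : ZMod n → A) :
    MulAction.orbitRel (DihedralGroup n) (ZMod n → A) f g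
      ↔ translationReflectionSetoid (unroll f) (unroll g) := by
  rw [Setoid.comm' (MulAction.orbitRel (DihedralGroup n) (ZMod n → A))]
  constructor
  · rintro ⟨j | j, rfl⟩ <;> obtain ⟨l, rfl⟩ := ZMod.intCast_surjective j
    · refine ⟨l, Or.inl (funext fun i => ?_)⟩
      simp [unroll, translate, dihedral_r_smul_apply]
    -- Since `reflect` is `i ↦ 1 - i`, the reflection `i ↦ l - i` is `reflect` followed by
    -- translation by `1 - l`.
    · refine ⟨1 - l, Or.inr (funext fun i => ?_)⟩
      simp only [unroll, translate, reflect, dihedral_sr_smul_apply]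
      congr 2
      push_cast
      ring
  · rintro ⟨l, hl | hl⟩
    · refine ⟨.r (l : ZMod n), (bijOn_unroll A n).injOn trivial trivial ?_⟩
      rw [hl]
      funext i
      simp [unroll, translate, dihedral_r_smul_apply]
    · refine ⟨.sr ((1 - l : ℤ) : ZMod n), (bijOn_unroll A n).injOn trivial trivial ?_⟩
      rw [hl]
      funext i
      simp only [unroll, translate, reflect, dihedral_sr_smul_apply]
      congr 2
      push_cast
      ring

theorem ncard_translation_classes_words (A : Finset ℝ) {n : ℕ} (hn : n ≠ 0) :
    ((classes translationSetoid (periodicWords A n)).ncard : ℚ) = N A.card n := by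
  have : NeZero n := ⟨hn⟩
  have h : (classes translationSetoid (periodicWords A n)).ncard
      = Nat.card (Quotient (MulAction.orbitRel (Multiplicative (ZMod n)) (ZMod n → A))) := by
    rw [classes, ← ncard_image_mk_congr _ _ (bijOn_unroll A n)
      (fun f _ g _ => translationSetoid_unroll_iff f g), Set.image_univ,
      Set.range_eq_univ.2 Quotient.mk_surjective, Set.ncard_univ]
  have h2 := card_cyclic_orbits A n
  rw [← h, Fintype.card_coe] at h2
  have hn' : (n : ℚ) ≠ 0 := by exact_mod_cast hn
  have h3 := congrArg (Nat.cast : ℕ → ℚ) h2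
  push_cast at h3
  rw [N, ← h3]
  field_simp

theorem ncard_translationReflection_classes_words (A : Finset ℝ) {n : ℕ} (hn : n ≠ 0) :
    ((classes translationReflectionSetoid (periodicWords A n)).ncard : ℚ) = B A.card n := by
  have : NeZero n := ⟨hn⟩
  have h : (classes translationReflectionSetoid (periodicWords A n)).ncard
      = Nat.card (Quotient (MulAction.orbitRel (DihedralGroup n) (ZMod n → A))) := by
    rw [classes, ← ncard_image_mk_congr _ _ (bijOn_unroll A n)
      (fun f _ g _ => translationReflectionSetoid_unroll_iff f g), Set.image_univ,
      Set.range_eq_univ.2 Quotient.mk_surjective, Set.ncard_univ]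
  have h2 := card_dihedral_orbits A n
  have hn' : (n : ℚ) ≠ 0 := by exact_mod_cast hn
  have hN : ((∑ m ∈ n.divisors, m.totient * A.card ^ (n / m) : ℕ) : ℚ) = n * N A.card n := by
    rw [N]
    push_cast
    field_simp
  rw [← h, Fintype.card_coe] at h2
  rcases Nat.even_or_odd' n with ⟨m, rfl | rfl⟩
  · have hm : m ≠ 0 := by omega
    have hm' : (m : ℚ) ≠ 0 := by exact_mod_cast hm
    rw [sum_card_reflection_invariant_even A hm, Fintype.card_coe] at h2
    have h3 := congrArg (Nat.cast : ℕ → ℚ) h2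
    rw [Nat.cast_add, hN] at h3
    push_cast at h3
    rw [B, if_pos (even_two_mul m), Nat.mul_div_cancel_left _ two_pos]
    have : (4 * m : ℚ) ≠ 0 := by positivity
    apply mul_right_cancel₀ this
    linear_combination h3
  · rw [sum_card_reflection_invariant_odd A m, Fintype.card_coe] at h2
    have h3 := congrArg (Nat.cast : ℕ → ℚ) h2
    rw [Nat.cast_add, hN] at h3
    push_cast at h3 hn'
    rw [B, if_neg (by simp), show (2 * m + 1 + 1) / 2 = m + 1 by omega]
    apply mul_right_cancel₀ (mul_ne_zero two_ne_zero hn')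
    linear_combination h3

end Nagumo

/-! ### Least periods, primitive words and Möbius inversion. -/

namespace Nagumo

open Function

theorem translate_one_iterate (m : ℕ) (u : ℤ → ℝ) : (translate 1)^[m] u = translate m u := by
  induction m with
  | zero => funext i; simp [translate]
  | succ m ih =>
    rw [iterate_succ_apply', ih]
    funext i
    exact congrArg u (by push_cast; ring)

/-- Turns the least period of a sequence into `minimalPeriod` of the shift. -/
theorem isPeriodicPt_translate_iff (m : ℕ) (u : ℤ → ℝ) :
    IsPeriodicPt (translate 1) m u ↔ ∀ i, u (i + m) = u i := by
  rw [IsPeriodicPt, IsFixedPt, translate_one_iterate, funext_iff]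
  rfl

theorem mem_primitivePart_periodicWords {A : Finset ℝ} {n : ℕ} (hn : n ≠ 0) (u : ℤ → ℝ) :
    u ∈ primitivePart n (periodicWords A n)
      ↔ (∀ i, u i ∈ A) ∧ minimalPeriod (translate 1) u = n := by
  have hn' := Nat.pos_of_ne_zero hn
  constructor
  · rintro ⟨⟨h1, h2⟩, h3⟩
    refine ⟨h1, ?_⟩
    rw [← isPeriodicPt_translate_iff] at h2
    refine (h2.minimalPeriod_le hn').eq_of_not_lt fun hlt => ?_
    refine h3 _ (h2.minimalPeriod_pos hn') hlt ?_
    rw [← isPeriodicPt_translate_iff]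
    exact isPeriodicPt_minimalPeriod _ _
  · rintro ⟨h1, rfl⟩
    refine ⟨⟨h1, ?_⟩, fun m hm hlt => ?_⟩
    · rw [← isPeriodicPt_translate_iff]
      exact isPeriodicPt_minimalPeriod _ _
    · rw [← isPeriodicPt_translate_iff]
      exact not_isPeriodicPt_of_pos_of_lt_minimalPeriod hm.ne' hlt

theorem minimalPeriod_translate (l : ℤ) (u : ℤ → ℝ) :
    minimalPeriod (translate 1) (translate l u) = minimalPeriod (translate 1) u := by
  rw [minimalPeriod_eq_minimalPeriod_iff]
  intro m
  rw [isPeriodicPt_translate_iff, isPeriodicPt_translate_iff]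
  refine ⟨fun h i => ?_, fun h i => ?_⟩
  · have := h (i - l)
    simp only [translate] at this
    rw [← sub_add_cancel i l, ← this]
    congr 1; ring
  · simp only [translate]
    rw [← h (i + l)]
    congr 1; ring

theorem minimalPeriod_reflect (u : ℤ → ℝ) :
    minimalPeriod (translate 1) (reflect u) = minimalPeriod (translate 1) u := by
  rw [minimalPeriod_eq_minimalPeriod_iff]
  intro m
  rw [isPeriodicPt_translate_iff, isPeriodicPt_translate_iff]
  refine ⟨fun h i => ?_, fun h i => ?_⟩
  · have := h (1 - (i + m))
    simp only [reflect] at this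
    rw [show (1 : ℤ) - (1 - (i + m)) = i + m by ring,
      show (1 : ℤ) - (1 - (i + m) + m) = i by ring] at this
    exact this.symm
  · simp only [reflect]
    rw [← h (1 - (i + m))]
    congr 1; ring

theorem minimalPeriod_eq_of_translationReflectionSetoid {u v : ℤ → ℝ}
    (h : translationReflectionSetoid u v) :
    minimalPeriod (translate 1) u = minimalPeriod (translate 1) v := by
  obtain ⟨l, rfl | rfl⟩ := h
  · exact (minimalPeriod_translate l u).symm
  · rw [minimalPeriod_translate, minimalPeriod_reflect]

theorem finite_classes {S : Set (ℤ → ℝ)} (r : Setoid (ℤ → ℝ)) (hS : S.Finite) :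
    (classes r S).Finite := hS.image _

/-- The least period is constant on classes and divides `n`, so it partitions the classes. The
relation is left general in order to cover both equality and the translation-reflection relation. -/
theorem sum_ncard_classes_primitivePart (A : Finset ℝ) {n : ℕ} (hn : n ≠ 0) (r : Setoid (ℤ → ℝ))
    (hr : ∀ u v, r u v → minimalPeriod (translate 1) u = minimalPeriod (translate 1) v) :
    ∑ m ∈ n.divisors, (classes r (primitivePart m (periodicWords A m))).ncard
      = (classes r (periodicWords A n)).ncard := by
  classical
  have hfin := finite_classes r (finite_periodicWords A hn)
  let P : Quotient r → ℕ := Quotient.lift (minimalPeriod (translate 1)) hr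
  have hdvd : ∀ u ∈ periodicWords A n, minimalPeriod (translate 1) u ∣ n := fun u hu =>
    ((isPeriodicPt_translate_iff n u).2 hu.2).minimalPeriod_dvd
  rw [Set.ncard_eq_toFinset_card _ hfin, Finset.card_eq_sum_card_fiberwise (f := P)
    (t := n.divisors)]
  · refine Finset.sum_congr rfl fun m hm => ?_
    have hmn := Nat.dvd_of_mem_divisors hm
    have hm0 : m ≠ 0 := (Nat.pos_of_mem_divisors hm).ne'
    rw [← Set.ncard_coe_finset]
    congr 1
    ext c
    simp only [Finset.coe_filter, Set.Finite.mem_toFinset, Set.mem_ofPred_eq]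
    constructor
    · rintro ⟨u, hu, rfl⟩
      rw [mem_primitivePart_periodicWords hm0] at hu
      refine ⟨⟨u, ⟨hu.1, ?_⟩, rfl⟩, hu.2⟩
      rw [← isPeriodicPt_translate_iff, isPeriodicPt_iff_minimalPeriod_dvd, hu.2]
      exact hmn
    · rintro ⟨⟨u, hu, rfl⟩, hc⟩
      exact ⟨u, (mem_primitivePart_periodicWords hm0 u).2 ⟨hu.1, hc⟩, rfl⟩
  · intro c hc
    obtain ⟨u, hu, rfl⟩ := hfin.mem_toFinset.1 hc
    exact Nat.mem_divisors.2 ⟨hdvd u hu, hn⟩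

/-- The first `n` translates of a primitive word are distinct and exhaust its class, so every class
has `n` elements. -/
theorem ncard_primitivePart (A : Finset ℝ) {n : ℕ} (hn : n ≠ 0) :
    (primitivePart n (periodicWords A n)).ncard
      = (classes translationSetoid (primitivePart n (periodicWords A n))).ncard * n := by
  classical
  have hfin : (primitivePart n (periodicWords A n)).Finite :=
    (finite_periodicWords A hn).subset fun u hu => hu.1
  have hcl := finite_classes translationSetoid hfin
  rw [Set.ncard_eq_toFinset_card _ hfin, Set.ncard_eq_toFinset_card _ hcl,
    Finset.card_eq_sum_card_fiberwise (f := Quotient.mk translationSetoid) (t := hcl.toFinset)]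
  · rw [Finset.sum_const_nat]
    intro c hc
    obtain ⟨u, hu, rfl⟩ := hcl.mem_toFinset.1 hc
    have hu' := (mem_primitivePart_periodicWords hn u).1 hu
    have hper : ∀ i, u (i + n) = u i := hu.1.2
    have : (hfin.toFinset.filter fun v => Quotient.mk translationSetoid v = ⟦u⟧)
        = (Finset.range n).image fun l : ℕ => (translate 1)^[l] u := by
      ext v
      simp only [Finset.mem_filter, Set.Finite.mem_toFinset, Finset.mem_image, Finset.mem_range]
      constructor
      · rintro ⟨hv, h⟩
        obtain ⟨l, rfl⟩ : translationSetoid u v := Quotient.exact h.symm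
        have hn0 : (n : ℤ) ≠ 0 := by exact_mod_cast hn
        have hnn := Int.emod_nonneg l hn0
        refine ⟨(l % n).toNat, ?_, ?_⟩
        · have := Int.emod_lt_of_pos l (show (0 : ℤ) < n by positivity)
          omega
        · rw [translate_one_iterate]
          funext i
          refine eq_of_intCast_eq hper ?_
          rw [Int.toNat_of_nonneg hnn]
          simp
      · rintro ⟨l, -, rfl⟩
        rw [translate_one_iterate, mem_primitivePart_periodicWords hn, minimalPeriod_translate]
        exact ⟨⟨fun i => hu'.1 _, hu'.2⟩, Quotient.sound (translationSetoid.symm ⟨(l : ℤ), rfl⟩)⟩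
    rw [this, Finset.card_image_of_injOn, Finset.card_range]
    intro l hl m hm h
    refine iterate_injOn_Iio_minimalPeriod (f := translate 1) (x := u) ?_ ?_ h
    · rw [hu'.2]; simpa using hl
    · rw [hu'.2]; simpa using hm
  · intro u hu
    exact hcl.mem_toFinset.2 ⟨u, hfin.mem_toFinset.1 hu, rfl⟩

theorem ncard_classes_bot (S : Set (ℤ → ℝ)) : (classes ⊥ S).ncard = S.ncard :=
  Set.InjOn.ncard_image fun _ _ _ _ h => Quotient.exact h

/-- Möbius inversion is applied to numbers of words, where the total is `k ^ n`; dividing by the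
common class size `n` gives `L`. -/
theorem ncard_translation_classes_primitive_words (A : Finset ℝ) {n : ℕ} (hn : n ≠ 0) :
    ((classes translationSetoid (primitivePart n (periodicWords A n))).ncard : ℚ)
      = L A.card n := by
  have key : ∀ n > 0, ∑ m ∈ n.divisors, ((primitivePart m (periodicWords A m)).ncard : ℚ)
      = (A.card : ℚ) ^ n := by
    intro n hn
    have h := sum_ncard_classes_primitivePart A hn.ne' ⊥ (by rintro u _ rfl; rfl)
    simp only [ncard_classes_bot, ncard_periodicWords A hn.ne'] at h
    exact_mod_cast h
  have h := ArithmeticFunction.sum_eq_iff_sum_mul_moebius_eq.1 key n (Nat.pos_of_ne_zero hn)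
  rw [ncard_primitivePart A hn,
    Nat.sum_divisorsAntidiagonal (fun x y => (ArithmeticFunction.moebius x : ℚ) * (A.card : ℚ) ^ y)]
    at h
  have hn' : (n : ℚ) ≠ 0 := by exact_mod_cast hn
  rw [L, h]
  push_cast
  field_simp

/-- Classes of primitive words may differ in size here, since some are mirror symmetric, so the
class counts themselves are inverted. -/
theorem ncard_translationReflection_classes_primitive_words (A : Finset ℝ) {n : ℕ} (hn : n ≠ 0) :
    ((classes translationReflectionSetoid (primitivePart n (periodicWords A n))).ncard : ℚ)
      = BL A.card n := by
  have key : ∀ n > 0, ∑ m ∈ n.divisors, ((classes translationReflectionSetoid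
      (primitivePart m (periodicWords A m))).ncard : ℚ) = B A.card n := by
    intro n hn
    rw [← ncard_translationReflection_classes_words A hn.ne',
      ← sum_ncard_classes_primitivePart A hn.ne' _
        fun _ _ => minimalPeriod_eq_of_translationReflectionSetoid]
    push_cast
    rfl
  have h := ArithmeticFunction.sum_eq_iff_sum_mul_moebius_eq.1 key n (Nat.pos_of_ne_zero hn)
  rw [Nat.sum_divisorsAntidiagonal
    (fun x y => (ArithmeticFunction.moebius x : ℚ) * B A.card y)] at h
  rw [BL, h]

/-! ### Transfer along an equivariant bijection -/

/-- The counts of elements and of equivalence classes of a set of `n`-periodic sequences, as they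
are for all words over an alphabet with `k` letters. -/
structure HasWordCounts (k n : ℕ) (S : Set (ℤ → ℝ)) : Prop where
  finite : S.Finite
  ncard : S.ncard = k ^ n
  translation : ((classes translationSetoid S).ncard : ℚ) = N k n
  translation_primitive : ((classes translationSetoid (primitivePart n S)).ncard : ℚ) = L k n
  reflection : ((classes translationReflectionSetoid S).ncard : ℚ) = B k n
  reflection_primitive :
    ((classes translationReflectionSetoid (primitivePart n S)).ncard : ℚ) = BL k n

theorem hasWordCounts_periodicWords (A : Finset ℝ) {n : ℕ} (hn : n ≠ 0) :
    HasWordCounts A.card n (periodicWords A n) :=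
  ⟨finite_periodicWords A hn, ncard_periodicWords A hn, ncard_translation_classes_words A hn,
    ncard_translation_classes_primitive_words A hn,
    ncard_translationReflection_classes_words A hn,
    ncard_translationReflection_classes_primitive_words A hn⟩

theorem translate_mem_periodicWords {A : Finset ℝ} {n : ℕ} {u : ℤ → ℝ}
    (hu : u ∈ periodicWords A n) (l : ℤ) : translate l u ∈ periodicWords A n :=
  ⟨fun i => hu.1 _, fun i => by simp only [translate]; rw [← hu.2 (i + l)]; congr 1; ring⟩

theorem reflect_mem_periodicWords {A : Finset ℝ} {n : ℕ} {u : ℤ → ℝ}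
    (hu : u ∈ periodicWords A n) : reflect u ∈ periodicWords A n :=
  ⟨fun i => hu.1 _, fun i => by
    simp only [reflect]; rw [← hu.2 (1 - (i + n))]; congr 1; ring⟩

/-- Equivalence and periodicity are equations between translated or reflected sequences; an
injective equivariant map preserves and reflects them. -/
theorem HasWordCounts.of_equivariant {A : Finset ℝ} {n : ℕ} (hn : n ≠ 0) {S : Set (ℤ → ℝ)}
    {e : (ℤ → ℝ) → ℤ → ℝ} (he : Set.BijOn e (periodicWords A n) S)
    (ht : ∀ u ∈ periodicWords A n, ∀ l, e (translate l u) = translate l (e u))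
    (hr : ∀ u ∈ periodicWords A n, e (reflect u) = reflect (e u)) :
    HasWordCounts A.card n S := by
  have h := hasWordCounts_periodicWords A hn
  have hT : ∀ u ∈ periodicWords A n, ∀ v ∈ periodicWords A n,
      (translationSetoid u v ↔ translationSetoid (e u) (e v)) := by
    intro u hu v hv
    refine exists_congr fun l => ?_
    rw [← ht u hu]
    exact (he.injOn.eq_iff hv (translate_mem_periodicWords hu l)).symm
  have hR : ∀ u ∈ periodicWords A n, ∀ v ∈ periodicWords A n,
      (translationReflectionSetoid u v ↔ translationReflectionSetoid (e u) (e v)) := by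
    intro u hu v hv
    have hu' := reflect_mem_periodicWords hu
    refine exists_congr fun l => or_congr ?_ ?_
    · rw [← ht u hu]
      exact (he.injOn.eq_iff hv (translate_mem_periodicWords hu l)).symm
    · rw [← hr u hu, ← ht _ hu']
      exact (he.injOn.eq_iff hv (translate_mem_periodicWords hu' l)).symm
  have hper : ∀ u ∈ periodicWords A n, ∀ m : ℕ, (∀ i, u (i + m) = u i) ↔
      ∀ i, e u (i + m) = e u i := by
    intro u hu m
    have h1 : (∀ i, u (i + m) = u i) ↔ translate m u = u := funext_iff.symm
    have h2 : (∀ i, e u (i + m) = e u i) ↔ translate m (e u) = e u := funext_iff.symm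
    rw [h1, h2, ← ht u hu, he.injOn.eq_iff (translate_mem_periodicWords hu m) hu]
  have hprim : Set.BijOn e (primitivePart n (periodicWords A n)) (primitivePart n S) := by
    refine ⟨fun u hu => ⟨he.mapsTo hu.1, fun m h0 h1 h2 => hu.2 m h0 h1 ((hper u hu.1 m).2 h2)⟩,
      he.injOn.mono fun u hu => hu.1, ?_⟩
    rintro v ⟨hv, hv'⟩
    obtain ⟨u, hu, rfl⟩ := he.surjOn hv
    exact ⟨u, ⟨hu, fun m h0 h1 h2 => hv' m h0 h1 ((hper u hu m).1 h2)⟩, rfl⟩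
  refine ⟨?_, ?_, ?_, ?_, ?_, ?_⟩
  · rw [← he.image_eq]
    exact h.finite.image e
  · rw [← he.image_eq, he.injOn.ncard_image, h.ncard]
  · rw [← h.translation, classes, classes, ncard_image_mk_congr _ _ he hT]
  · rw [← h.translation_primitive, classes, classes,
      ncard_image_mk_congr _ _ hprim fun u hu v hv => hT u hu.1 v hv.1]
  · rw [← h.reflection, classes, classes, ncard_image_mk_congr _ _ he hR]
  · rw [← h.reflection_primitive, classes, classes,
      ncard_image_mk_congr _ _ hprim fun u hu v hv => hR u hu.1 v hv.1]

end Nagumo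

/-! ### Continuation of words to stationary solutions for small `d`. -/

namespace Nagumo

/-- The zeros of the nonlinearity `g(·; a)`. -/
noncomputable def zeros (a : ℝ) : Finset ℝ := {0, a, 1}

/-- The slope of the secant of `g(·; a)` through `u` and `v`. -/
def secantSlope (a u v : ℝ) : ℝ := -(u ^ 2 + u * v + v ^ 2) + (1 + a) * (u + v) - a

theorem g_sub_g (a u v : ℝ) : g a u - g a v = secantSlope a u v * (u - v) := by
  simp only [g, secantSlope]; ring

/-- The radius of the neighbourhoods of the zeros in which the slope of `g` is controlled. -/
noncomputable def radius (a : ℝ) : ℝ := a * (1 - a) / 128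

section

variable {a : ℝ} (ha : a ∈ Set.Ioo (0 : ℝ) 1)
include ha

theorem radius_pos : 0 < radius a := by
  have := mul_pos ha.1 (sub_pos.2 ha.2)
  simp only [radius]; linarith

theorem radius_mul_le : 128 * radius a ≤ a ∧ 128 * radius a ≤ 1 - a := by
  obtain ⟨h0, h1⟩ := ha
  simp only [radius]
  constructor <;> nlinarith

theorem g_eq_zero_of_mem {s : ℝ} (hs : s ∈ zeros a) : g a s = 0 := by
  simp only [zeros, Finset.mem_insert, Finset.mem_singleton] at hs
  rcases hs with rfl | rfl | rfl <;> simp [g]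

theorem mem_Icc_of_mem_zeros {s : ℝ} (hs : s ∈ zeros a) : s ∈ Set.Icc (0 : ℝ) 1 := by
  simp only [zeros, Finset.mem_insert, Finset.mem_singleton] at hs
  rcases hs with rfl | rfl | rfl
  · simp
  · exact ⟨ha.1.le, ha.2.le⟩
  · simp

theorem card_zeros : (zeros a).card = 3 := by
  rw [zeros, Finset.card_eq_three]
  exact ⟨0, a, 1, ha.1.ne, by simp, ha.2.ne, rfl⟩

/-- The distance `2 * radius a` leaves room for a state within one radius of a stationary solution
that is itself within one radius of its word. -/
theorem abs_secantSlope_sub_le {s u v : ℝ} (hs : s ∈ zeros a) (hu : |u - s| ≤ 2 * radius a)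
    (hv : |v - s| ≤ 2 * radius a) :
    |secantSlope a u v - secantSlope a s s| ≤ 32 * radius a := by
  obtain ⟨hs0, hs1⟩ := mem_Icc_of_mem_zeros ha hs
  have hr := radius_pos ha
  have hr1 := radius_mul_le ha
  obtain ⟨ha0, ha1⟩ := ha
  obtain ⟨p, rfl⟩ : ∃ p, u = s + p := ⟨u - s, by ring⟩
  obtain ⟨q, rfl⟩ : ∃ q, v = s + q := ⟨v - s, by ring⟩
  rw [add_sub_cancel_left] at hu hv
  have e : secantSlope a (s + p) (s + q) - secantSlope a s s
      = p * (1 + a - 3 * s - p - q) + q * (1 + a - 3 * s - q) := by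
    simp only [secantSlope]; ring
  have hp := abs_le.1 hu
  have hq := abs_le.1 hv
  have h1 : |1 + a - 3 * s - p - q| ≤ 4 := abs_le.2 ⟨by linarith, by linarith⟩
  have h2 : |1 + a - 3 * s - q| ≤ 4 := abs_le.2 ⟨by linarith, by linarith⟩
  rw [e]
  refine (abs_add_le _ _).trans ?_
  rw [abs_mul, abs_mul]
  have h3 : |p| * |1 + a - 3 * s - p - q| ≤ 2 * radius a * 4 := by gcongr
  have h4 : |q| * |1 + a - 3 * s - q| ≤ 2 * radius a * 4 := by gcongr
  linarith

/-- `secantSlope a s s` is the derivative of `g` at `s`: `-a`, `a(1 - a)` and `-(1 - a)` at the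
three zeros. All have modulus at least `a(1 - a)`. -/
theorem le_abs_secantSlope {s : ℝ} (hs : s ∈ zeros a) :
    128 * radius a ≤ |secantSlope a s s| := by
  obtain ⟨ha0, ha1⟩ := ha
  simp only [zeros, Finset.mem_insert, Finset.mem_singleton] at hs
  simp only [secantSlope, radius]
  rcases hs with rfl | rfl | rfl
  · rw [le_abs]; right; nlinarith
  · rw [le_abs]; left; nlinarith
  · rw [le_abs]; right; nlinarith

/-- If all three factors of `g` exceeded the radius, their product would exceed its cube. -/
theorem exists_zero_near {u : ℝ} (hg : |g a u| ≤ radius a ^ 3) :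
    ∃ s ∈ zeros a, |u - s| ≤ radius a := by
  have hr := radius_pos ha
  by_contra! h
  simp only [zeros, Finset.mem_insert, Finset.mem_singleton, forall_eq_or_imp, forall_eq] at h
  obtain ⟨h0, h1, h2⟩ := h
  rw [sub_zero] at h0
  rw [abs_sub_comm] at h2
  have h3 : radius a ^ 3 < |u| * |1 - u| * |u - a| := by
    calc radius a ^ 3 = radius a * radius a * radius a := by ring
      _ < |u| * |1 - u| * |u - a| := by gcongr
  rw [g, abs_mul, abs_mul] at hg
  linarith

theorem eq_of_near_zeros {s t u : ℝ} (hs : s ∈ zeros a) (ht : t ∈ zeros a)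
    (hus : |u - s| ≤ radius a) (hut : |u - t| ≤ radius a) : s = t := by
  have hr := radius_pos ha
  obtain ⟨h1, h2⟩ := radius_mul_le ha
  rw [abs_le] at hus hut
  obtain ⟨ha0, ha1⟩ := ha
  simp only [zeros, Finset.mem_insert, Finset.mem_singleton] at hs ht
  rcases hs with rfl | rfl | rfl <;> rcases ht with rfl | rfl | rfl <;>
    first | rfl | (exfalso; linarith)

/-- This is one coordinate of the Newton map with derivative frozen at the letter, where `d = 0`.
The variation of the slope contributes `32 * radius a` and the coupling `4 * d ≤ 32 * radius a`;
division by a slope of at least `128 * radius a` leaves the factor `1/2`. -/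
theorem newton_sub_newton_le {d s u₁ u₂ u₃ v₁ v₂ v₃ D : ℝ} (hd : 0 ≤ d) (hd' : d ≤ 8 * radius a)
    (hs : s ∈ zeros a) (hu : |u₂ - s| ≤ radius a) (hv : |v₂ - s| ≤ radius a)
    (h₁ : |u₁ - v₁| ≤ D) (h₂ : |u₂ - v₂| ≤ D) (h₃ : |u₃ - v₃| ≤ D) :
    |(u₂ - (d * (u₁ - 2 * u₂ + u₃) + g a u₂) / secantSlope a s s)
      - (v₂ - (d * (v₁ - 2 * v₂ + v₃) + g a v₂) / secantSlope a s s)| ≤ D / 2 := by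
  have hr := radius_pos ha
  have hσ := le_abs_secantSlope ha hs
  have hS := abs_secantSlope_sub_le ha hs (u := u₂) (v := v₂) (by linarith) (by linarith)
  have hD : 0 ≤ D := (abs_nonneg _).trans h₂
  have hg := g_sub_g a u₂ v₂
  set σ := secantSlope a s s
  set S := secantSlope a u₂ v₂
  have hσ0 : σ ≠ 0 := by
    intro h
    rw [h, abs_zero] at hσ
    linarith
  have e : (u₂ - (d * (u₁ - 2 * u₂ + u₃) + g a u₂) / σ)
      - (v₂ - (d * (v₁ - 2 * v₂ + v₃) + g a v₂) / σ)
      = (-(S - σ) * (u₂ - v₂) - d * ((u₁ - v₁) - 2 * (u₂ - v₂) + (u₃ - v₃))) / σ := by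
    rw [eq_div_iff hσ0]
    field_simp
    linear_combination -hg
  rw [e, abs_div, div_le_iff₀ (abs_pos.2 hσ0)]
  have h4 : |u₁ - v₁ - 2 * (u₂ - v₂) + (u₃ - v₃)| ≤ 4 * D := by
    rw [abs_le] at *
    constructor <;> linarith
  calc |(-(S - σ) * (u₂ - v₂) - d * ((u₁ - v₁) - 2 * (u₂ - v₂) + (u₃ - v₃)))|
      ≤ |-(S - σ) * (u₂ - v₂)| + |d * ((u₁ - v₁) - 2 * (u₂ - v₂) + (u₃ - v₃))| := abs_sub _ _
    _ = |S - σ| * |u₂ - v₂| + d * |(u₁ - v₁) - 2 * (u₂ - v₂) + (u₃ - v₃)| := by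
      rw [abs_mul, abs_neg, abs_mul, abs_of_nonneg hd]
    _ ≤ (32 * radius a) * D + (8 * radius a) * (4 * D) := by gcongr
    _ = D / 2 * (128 * radius a) := by ring
    _ ≤ D / 2 * |σ| := by gcongr

/-- Maximum principle: periodicity ensures that extrema are attained. At a negative minimum, or a
maximum above `1`, the diffusion and `g` cannot cancel. -/
theorem mem_Icc_of_periodicStationary {n : ℕ} (hn : n ≠ 0) {d : ℝ} (hd : 0 < d) {u : ℤ → ℝ}
    (hu : u ∈ periodicStationary n a d) (i : ℤ) : u i ∈ Set.Icc (0 : ℝ) 1 := by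
  have : NeZero n := ⟨hn⟩
  obtain ⟨ha0, ha1⟩ := ha
  obtain ⟨f, hf⟩ := exists_zmod_of_periodic hu.2
  constructor
  · obtain ⟨x, hx⟩ := Finite.exists_min f
    obtain ⟨j, rfl⟩ := ZMod.intCast_surjective x
    have hmin : ∀ k, u j ≤ u k := fun k => by rw [← hf, ← hf]; exact hx k
    refine le_trans ?_ (hmin i)
    by_contra! hneg
    have h := hu.1 j
    have h1 : 0 ≤ d * (u (j - 1) - 2 * u j + u (j + 1)) :=
      mul_nonneg hd.le (by linarith [hmin (j - 1), hmin (j + 1)])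
    have h2 : 0 < g a (u j) :=
      mul_pos_of_neg_of_neg (mul_neg_of_neg_of_pos hneg (by linarith)) (by linarith)
    rw [rhs] at h
    linarith
  · obtain ⟨x, hx⟩ := Finite.exists_max f
    obtain ⟨j, rfl⟩ := ZMod.intCast_surjective x
    have hmax : ∀ k, u k ≤ u j := fun k => by rw [← hf, ← hf]; exact hx k
    refine (hmax i).trans ?_
    by_contra! hgt
    have h := hu.1 j
    have h1 : d * (u (j - 1) - 2 * u j + u (j + 1)) ≤ 0 :=
      mul_nonpos_of_nonneg_of_nonpos hd.le (by linarith [hmax (j - 1), hmax (j + 1)])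
    have h2 : g a (u j) < 0 :=
      mul_neg_of_neg_of_pos (mul_neg_of_pos_of_neg (by linarith) (by linarith)) (by linarith)
    rw [rhs] at h
    linarith

theorem exists_word_near {n : ℕ} (hn : n ≠ 0) {d : ℝ} (hd : 0 < d) (hd' : 2 * d ≤ radius a ^ 3)
    {u : ℤ → ℝ} (hu : u ∈ periodicStationary n a d) :
    ∃ s ∈ periodicWords (zeros a) n, ∀ i, |u i - s i| ≤ radius a := by
  have hIcc := mem_Icc_of_periodicStationary ha hn hd hu
  obtain ⟨f, hf⟩ := exists_zmod_of_periodic hu.2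
  -- Letters are chosen on `ZMod n`, so that the resulting word is periodic.
  have key : ∀ x : ZMod n, ∃ s ∈ zeros a, |f x - s| ≤ radius a := by
    intro x
    obtain ⟨i, rfl⟩ := ZMod.intCast_surjective x
    rw [hf]
    refine exists_zero_near ha (le_trans ?_ hd')
    have h := hu.1 i
    rw [rhs] at h
    have h1 : |u (i - 1) - 2 * u i + u (i + 1)| ≤ 2 := by
      obtain ⟨a1, b1⟩ := hIcc (i - 1)
      obtain ⟨a2, b2⟩ := hIcc i
      obtain ⟨a3, b3⟩ := hIcc (i + 1)
      exact abs_le.2 ⟨by linarith, by linarith⟩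
    rw [show g a (u i) = -(d * (u (i - 1) - 2 * u i + u (i + 1))) by linarith, abs_neg, abs_mul,
      abs_of_pos hd, mul_comm]
    gcongr
  choose s hs hsf using key
  refine ⟨fun i => s i, ⟨fun i => hs i, fun i => by simp⟩, fun i => ?_⟩
  rw [← hf]
  exact hsf i

theorem word_unique {n : ℕ} {s t u : ℤ → ℝ} (hs : s ∈ periodicWords (zeros a) n)
    (ht : t ∈ periodicWords (zeros a) n) (hus : ∀ i, |u i - s i| ≤ radius a)
    (hut : ∀ i, |u i - t i| ≤ radius a) : s = t :=
  funext fun i => eq_of_near_zeros ha (hs.1 i) (ht.1 i) (hus i) (hut i)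

theorem radius_le_one : radius a ≤ 1 := by
  linarith [(radius_mul_le ha).1, ha.2, radius_pos ha]

theorem le_radius_of_two_mul_le {d : ℝ} (hd : 2 * d ≤ radius a ^ 3) :
    d ≤ radius a ^ 2 := by
  have h1 := radius_le_one ha
  have h2 := radius_pos ha
  nlinarith [sq_nonneg (radius a)]

theorem le_eight_mul_radius {d : ℝ} (hd : 2 * d ≤ radius a ^ 3) : d ≤ 8 * radius a := by
  have h0 := le_radius_of_two_mul_le ha hd
  have h1 := radius_le_one ha
  have h2 := radius_pos ha
  nlinarith

/-- Both solutions are fixed by the Newton map; at the site where they differ most, the contraction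
halves a difference that it must preserve. -/
theorem stationary_unique {n : ℕ} (hn : n ≠ 0) {d : ℝ} (hd : 0 < d) (hd' : 2 * d ≤ radius a ^ 3)
    {s u v : ℤ → ℝ} (hs : s ∈ periodicWords (zeros a) n) (hu : u ∈ periodicStationary n a d)
    (hv : v ∈ periodicStationary n a d) (hus : ∀ i, |u i - s i| ≤ radius a)
    (hvs : ∀ i, |v i - s i| ≤ radius a) : u = v := by
  have : NeZero n := ⟨hn⟩
  obtain ⟨f, hf⟩ := exists_zmod_of_periodic (u := fun i => |u i - v i|) (n := n)
    (fun i => by rw [hu.2, hv.2])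
  obtain ⟨x, hx⟩ := Finite.exists_max f
  obtain ⟨j, rfl⟩ := ZMod.intCast_surjective x
  have hmax : ∀ k, |u k - v k| ≤ |u j - v j| := fun k => by
    have := hx k
    rwa [hf, hf] at this
  have h := newton_sub_newton_le ha hd.le (le_eight_mul_radius ha hd') (hs.1 j) (hus j) (hvs j)
    (hmax (j - 1)) le_rfl (hmax (j + 1))
  have h1 := hu.1 j
  have h2 := hv.1 j
  rw [rhs] at h1 h2
  rw [h1, h2, zero_div, sub_zero, sub_zero] at h
  funext k
  have h3 := hmax k
  have h4 := abs_nonneg (u k - v k)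
  have : |u k - v k| = 0 := by linarith
  exact sub_eq_zero.1 (abs_eq_zero.1 this)

theorem exists_stationary_near {n : ℕ} (hn : n ≠ 0) {d : ℝ} (hd : 0 < d)
    (hd' : 2 * d ≤ radius a ^ 3) {s : ℤ → ℝ} (hs : s ∈ periodicWords (zeros a) n) :
    ∃ u ∈ periodicStationary n a d, ∀ i, |u i - s i| ≤ radius a := by
  have : NeZero n := ⟨hn⟩
  have hr := radius_pos ha
  obtain ⟨w, hw⟩ := exists_zmod_of_periodic hs.2
  have hwz : ∀ x, w x ∈ zeros a := fun x => by
    obtain ⟨i, rfl⟩ := ZMod.intCast_surjective x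
    rw [hw]
    exact hs.1 i
  let T : (ZMod n → ℝ) → ZMod n → ℝ := fun v x =>
    v x - (d * (v (x - 1) - 2 * v x + v (x + 1)) + g a (v x)) / secantSlope a (w x) (w x)
  have hball : ∀ v ∈ Metric.closedBall w (radius a), ∀ x, |v x - w x| ≤ radius a :=
    fun v hv x => (norm_le_pi_norm (v - w) x).trans (by simpa [dist_eq_norm] using hv)
  have hT : ∀ u ∈ Metric.closedBall w (radius a), ∀ v ∈ Metric.closedBall w (radius a),
      dist (T u) (T v) ≤ dist u v / 2 := by
    intro u hu v hv
    have hD : ∀ x, |u x - v x| ≤ dist u v := fun x => by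
      rw [dist_eq_norm]; exact norm_le_pi_norm (u - v) x
    refine (dist_pi_le_iff (by positivity)).2 fun x => ?_
    exact newton_sub_newton_le ha hd.le (le_eight_mul_radius ha hd') (hwz x) (hball u hu x)
      (hball v hv x) (hD _) (hD _) (hD _)
  -- Half a radius of displacement at the centre, plus half a radius from the contraction, keeps the
  -- ball invariant.
  have hTw : dist (T w) w ≤ radius a / 2 := by
    refine (dist_pi_le_iff (by positivity)).2 fun x => ?_
    have hσ := le_abs_secantSlope ha (hwz x)
    rw [Real.dist_eq]
    simp only [T]
    rw [sub_sub_cancel_left, abs_neg, g_eq_zero_of_mem ha (hwz x), add_zero, abs_div, abs_mul,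
      abs_of_pos hd, div_le_iff₀ (by linarith)]
    have h1 : |w (x - 1) - 2 * w x + w (x + 1)| ≤ 2 := by
      obtain ⟨a1, b1⟩ := mem_Icc_of_mem_zeros ha (hwz (x - 1))
      obtain ⟨a2, b2⟩ := mem_Icc_of_mem_zeros ha (hwz x)
      obtain ⟨a3, b3⟩ := mem_Icc_of_mem_zeros ha (hwz (x + 1))
      exact abs_le.2 ⟨by linarith, by linarith⟩
    calc d * |w (x - 1) - 2 * w x + w (x + 1)| ≤ radius a ^ 2 * 2 := by
          gcongr
          exact le_radius_of_two_mul_le ha hd'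
      _ ≤ radius a / 2 * (128 * radius a) := by nlinarith
      _ ≤ _ := by gcongr
  have hself : w ∈ Metric.closedBall w (radius a) := Metric.mem_closedBall_self hr.le
  have hmaps : Set.MapsTo T (Metric.closedBall w (radius a)) (Metric.closedBall w (radius a)) := by
    intro v hv
    rw [Metric.mem_closedBall]
    have h1 := hT v hv w hself
    have h2 := dist_triangle (T v) (T w) w
    have h3 := Metric.mem_closedBall.1 hv
    linarith
  have hcontr : ContractingWith (1 / 2) (hmaps.restrict T _ _) := by
    refine ⟨by norm_num, LipschitzWith.of_dist_le_mul fun u v => ?_⟩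
    have := hT u u.2 v v.2
    rw [Subtype.dist_eq, Subtype.dist_eq]
    simp only [Set.MapsTo.val_restrict_apply]
    refine this.trans (le_of_eq ?_)
    simp
    ring
  obtain ⟨f, hfball, hfix, -⟩ := hcontr.exists_fixedPoint' Metric.isClosed_closedBall.isComplete
    hmaps hself (edist_ne_top _ _)
  refine ⟨fun i => f i, ⟨fun i => ?_, fun i => by simp⟩, fun i => ?_⟩
  · have h := congrFun hfix (i : ZMod n)
    have hσ := le_abs_secantSlope ha (hwz i)
    have hσ0 : secantSlope a (w i) (w i) ≠ 0 := fun h0 => by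
      rw [h0, abs_zero] at hσ
      linarith
    simp only [T] at h
    rw [sub_eq_self, div_eq_zero_iff, or_iff_left hσ0] at h
    simpa [rhs] using h
  · rw [← hw]
    exact hball f hfball i

end

end Nagumo

/-! ### Differential inequalities and forward existence in Banach spaces. -/

namespace Nagumo

open Set Filter Topology

section

variable {E : Type*} [NormedAddCommGroup E] [NormedSpace ℝ E]

/-- A differential inequality for the norm of a curve, in terms of forward Euler steps. -/
theorem norm_le_of_euler_step {w w' : ℝ → E} {b b' : ℝ → ℝ}
    (hw : ∀ t, 0 ≤ t → HasDerivWithinAt w (w' t) (Ici 0) t) (h0 : ‖w 0‖ ≤ b 0)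
    (hb : ∀ t, HasDerivAt b (b' t) t)
    (hstep : ∀ t, 0 ≤ t → ‖w t‖ = b t → ∃ m < b' t, ∃ h₀ > 0, ∀ h, 0 < h → h < h₀ →
      ‖w t + h • w' t‖ ≤ ‖w t‖ + h * m) {t : ℝ} (ht : 0 ≤ t) : ‖w t‖ ≤ b t := by
  classical
  -- The barrier argument compares rates only at contact times; elsewhere the trivial rate `‖w' t‖`
  -- will do.
  have hstep' : ∀ t, ∃ m, 0 ≤ t → (‖w t‖ = b t → m < b' t) ∧ ∃ h₀ > 0, ∀ h, 0 < h → h < h₀ →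
      ‖w t + h • w' t‖ ≤ ‖w t‖ + h * m := by
    intro t
    by_cases ht : 0 ≤ t
    · by_cases he : ‖w t‖ = b t
      · obtain ⟨m, hm, H⟩ := hstep t ht he
        exact ⟨m, fun _ => ⟨fun _ => hm, H⟩⟩
      · refine ⟨‖w' t‖, fun _ => ⟨fun h => absurd h he, 1, one_pos, fun h hh _ => ?_⟩⟩
        refine (norm_add_le _ _).trans ?_
        rw [norm_smul, Real.norm_of_nonneg hh.le]
    · exact ⟨0, fun h => absurd h ht⟩
  choose f' hf' using hstep'
  have hcont : ContinuousOn (fun s => ‖w s‖) (Icc 0 t) := fun s hs =>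
    ((hw s hs.1).continuousWithinAt.mono Icc_subset_Ici_self).norm
  refine image_le_of_liminf_slope_right_lt_deriv_boundary (f' := f') hcont ?_ h0 hb
    (fun s hs he => (hf' s hs.1).1 he) ⟨ht, le_rfl⟩
  intro s hs r hr
  obtain ⟨h₀, hh₀, H⟩ := (hf' s hs.1).2
  have hder : HasDerivWithinAt w (w' s) (Ioi s) s :=
    (hw s hs.1).mono fun z hz => hs.1.trans (le_of_lt hz)
  -- The curve differs from its Euler step by `o(z - s)`, so the growth bound on the step passes to
  -- the norm.
  have hlo := (hasDerivWithinAt_iff_isLittleO.1 hder).def (c := (r - f' s) / 2)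
    (by linarith)
  refine Eventually.frequently ?_
  filter_upwards [hlo, Ioo_mem_nhdsGT (show s < s + h₀ by linarith)] with z hz hzs
  have hpos : 0 < z - s := sub_pos.2 hzs.1
  rw [slope_def_field, div_lt_iff₀ hpos]
  have h1 := H (z - s) hpos (by linarith [hzs.2])
  rw [Real.norm_of_nonneg hpos.le] at hz
  have h2 : ‖w z‖ ≤ ‖w z - w s - (z - s) • w' s‖ + ‖w s + (z - s) • w' s‖ := by
    refine le_trans (le_of_eq ?_) (norm_add_le _ _)
    congr 1
    abel
  nlinarith

/-- The barrier decays at rate `c / 2`, while on contact the norm decays at rate at least `c`; this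
gives the strict inequality. Being at most `r`, the barrier keeps contact points where `hdec`
applies. -/
theorem norm_sub_le_exp_of_contracting_step {F : E → E} {x : E} {r c ρ : ℝ} (hc : 0 < c)
    (hdec : ∀ y, ‖y - x‖ ≤ r → ∃ h₀ > 0, ∀ h, 0 < h → h < h₀ →
      ‖y - x + h • F y‖ ≤ (1 - h * c) * ‖y - x‖)
    (hρ : 0 < ρ) (hρr : ρ ≤ r) {u : ℝ → E} (hu : IsForwardSolution F u) (h0 : ‖u 0 - x‖ ≤ ρ)
    {t : ℝ} (ht : 0 ≤ t) : ‖u t - x‖ ≤ ρ * Real.exp (-(c / 2) * t) := by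
  refine norm_le_of_euler_step (w := fun t => u t - x) (w' := fun t => F (u t))
    (b := fun t => ρ * Real.exp (-(c / 2) * t))
    (b' := fun t => ρ * (Real.exp (-(c / 2) * t) * (-(c / 2))))
    (fun t ht => (hu t ht).sub_const x) (by simpa using h0) (fun t => ?_) (fun t ht he => ?_) ht
  · have : HasDerivAt (fun t : ℝ => -(c / 2) * t) (-(c / 2)) t := by
      simpa using (hasDerivAt_id t).const_mul (-(c / 2))
    exact this.exp.const_mul ρ
  · have hpos : 0 < ρ * Real.exp (-(c / 2) * t) := by positivity
    have hle : Real.exp (-(c / 2) * t) ≤ 1 := Real.exp_le_one_iff.2 (by nlinarith)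
    have hr : ‖u t - x‖ ≤ r := by
      simp only [he]
      nlinarith
    obtain ⟨h₀, hh₀, H⟩ := hdec _ hr
    refine ⟨-c * ‖u t - x‖, ?_, h₀, hh₀, fun h h1 h2 => (H h h1 h2).trans (le_of_eq (by ring))⟩
    rw [he]
    nlinarith

theorem isAsymptoticallyStable_of_contracting_step {F : E → E} {x : E} {r c : ℝ} (hr : 0 < r)
    (hc : 0 < c)
    (hdec : ∀ y, ‖y - x‖ ≤ r → ∃ h₀ > 0, ∀ h, 0 < h → h < h₀ →
      ‖y - x + h • F y‖ ≤ (1 - h * c) * ‖y - x‖)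
    (hex : ∀ x₀, ‖x₀ - x‖ < r → ∃ u, IsForwardSolution F u ∧ u 0 = x₀) :
    IsAsymptoticallyStable F x := by
  refine ⟨fun ε hε => ⟨min r ε / 2, by positivity, fun x₀ hx₀ => ⟨hex x₀ ?_, ?_⟩⟩,
    r, hr, fun x₀ hx₀ => ⟨hex x₀ hx₀, ?_⟩⟩
  · have := min_le_left r ε
    linarith
  · rintro u hu rfl t ht
    have h1 := min_le_left r ε
    have h2 := min_le_right r ε
    refine (norm_sub_le_exp_of_contracting_step hc hdec (by positivity) (by linarith) hu hx₀.le
      ht).trans_lt ?_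
    have hle : Real.exp (-(c / 2) * t) ≤ 1 := Real.exp_le_one_iff.2 (by nlinarith)
    have h3 : 0 < min r ε := by positivity
    nlinarith
  · rintro u hu rfl
    rw [tendsto_iff_norm_sub_tendsto_zero]
    refine squeeze_zero' (Eventually.of_forall fun t => norm_nonneg _)
      ((eventually_ge_atTop 0).mono fun t ht =>
        norm_sub_le_exp_of_contracting_step hc hdec hr le_rfl hu hx₀.le ht) ?_
    have h1 : Tendsto (fun t : ℝ => -(c / 2) * t) atTop atBot :=
      tendsto_id.const_mul_atTop_of_neg (by linarith)
    simpa using (Real.tendsto_exp_atBot.comp h1).const_mul r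

/-- A global bound `M` confines the solution to a ball of radius `M * T`, so Picard–Lindelöf works
for every `T`. -/
theorem exists_solution_Icc_of_lipschitzWith [CompleteSpace E] {F : E → E} {K : NNReal}
    (hF : LipschitzWith K F) {M : NNReal} (hM : ∀ x, ‖F x‖ ≤ M) (x₀ : E) {T : ℝ} (hT : 0 ≤ T) :
    ∃ u : ℝ → E, u 0 = x₀ ∧ ∀ t ∈ Icc 0 T, HasDerivWithinAt u (F (u t)) (Icc 0 T) t := by
  have h : IsPicardLindelof (fun _ => F) (⟨0, le_rfl, hT⟩ : Icc 0 T) x₀ (M * T.toNNReal) 0 M K :=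
    IsPicardLindelof.of_time_independent (fun x _ => hM x) hF.lipschitzOnWith
      (by simp [hT])
  exact h.exists_eq_forall_mem_Icc_hasDerivWithinAt₀

/-- Solutions on the intervals `[0, n]` agree on overlaps by uniqueness and glue together. -/
theorem exists_isForwardSolution_of_lipschitzWith [CompleteSpace E] {F : E → E} {K : NNReal}
    (hF : LipschitzWith K F) {M : NNReal} (hM : ∀ x, ‖F x‖ ≤ M) (x₀ : E) :
    ∃ u, IsForwardSolution F u ∧ u 0 = x₀ := by
  choose α hα0 hα using fun n : ℕ =>
    exists_solution_Icc_of_lipschitzWith hF hM x₀ (T := n) (Nat.cast_nonneg n)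
  have hder : ∀ n : ℕ, ∀ t ∈ Ico (0 : ℝ) n, HasDerivWithinAt (α n) (F (α n t)) (Ici t) t :=
    fun n t ht => (hα n t ⟨ht.1, ht.2.le⟩).mono_of_mem_nhdsWithin
      (mem_of_superset (Icc_mem_nhdsGE ht.2) (Icc_subset_Icc_left ht.1))
  have hagree : ∀ m n : ℕ, ∀ t : ℝ, 0 ≤ t → t ≤ m → t ≤ n → α m t = α n t := by
    intro m n t ht hm hn
    refine ODE_solution_unique (v := fun _ => F) (K := K) (a := 0) (b := t) (fun _ => hF)
      (fun s hs => ?_) (fun s hs => hder m s ⟨hs.1, hs.2.trans_le hm⟩)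
      (fun s hs => ?_) (fun s hs => hder n s ⟨hs.1, hs.2.trans_le hn⟩)
      (by rw [hα0, hα0]) ⟨ht, le_rfl⟩
    · exact (hα m s ⟨hs.1, hs.2.trans hm⟩).continuousWithinAt.mono (Icc_subset_Icc_right hm)
    · exact (hα n s ⟨hs.1, hs.2.trans hn⟩).continuousWithinAt.mono (Icc_subset_Icc_right hn)
  refine ⟨fun t => α ⌈t⌉₊ t, fun t ht => ?_, by simp [hα0]⟩
  -- One more unit of time gives a solution defined on both sides of `t`, even when `t` is a
  -- positive integer.
  have hlt : t < ((⌈t⌉₊ + 1 : ℕ) : ℝ) := by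
    push_cast
    linarith [Nat.le_ceil t]
  have hd := hα (⌈t⌉₊ + 1) t ⟨ht, hlt.le⟩
  have heq : ∀ s, 0 ≤ s → s ≤ ((⌈t⌉₊ + 1 : ℕ) : ℝ) → α ⌈s⌉₊ s = α (⌈t⌉₊ + 1) s :=
    fun s h0 h1 => hagree _ _ s h0 (Nat.le_ceil s) h1
  change HasDerivWithinAt (fun t => α ⌈t⌉₊ t) (F (α ⌈t⌉₊ t)) (Ici 0) t
  rw [heq t ht hlt.le]
  refine (hd.congr (fun s hs => heq s hs.1 hs.2) (heq t ht hlt.le)).mono_of_mem_nhdsWithin ?_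
  rw [← Ici_inter_Iic]
  exact inter_mem_nhdsWithin _ (Iic_mem_nhds hlt)

end

/-! ### The lattice field on `ℓ^∞` -/

theorem abs_apply_le_norm (u : LInf) (i : ℤ) : |u i| ≤ ‖u‖ :=
  lp.norm_apply_le_norm ENNReal.top_ne_zero u i

theorem norm_le_of_forall_abs_le {u : LInf} {C : ℝ} (hC : 0 ≤ C) (h : ∀ i, |u i| ≤ C) :
    ‖u‖ ≤ C := lp.norm_le_of_forall_le hC h

/-- Componentwise truncation of a bounded sequence to `[-4, 4]`. -/
noncomputable def clip (u : LInf) : LInf :=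
  ⟨fun i => max (-4) (min 4 (u i)), memℓp_infty ⟨4, by
    rintro _ ⟨i, rfl⟩
    exact abs_le.2 ⟨le_max_left _ _, max_le (by norm_num) (min_le_left _ _)⟩⟩⟩

theorem clip_apply (u : LInf) (i : ℤ) : clip u i = max (-4) (min 4 (u i)) := rfl

theorem norm_clip_le (u : LInf) : ‖clip u‖ ≤ 4 :=
  norm_le_of_forall_abs_le (by norm_num) fun _ =>
    abs_le.2 ⟨le_max_left _ _, max_le (by norm_num) (min_le_left _ _)⟩

theorem clip_eq_self {u : LInf} (hu : ‖u‖ ≤ 4) : clip u = u := by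
  ext i
  have h := abs_le.1 ((abs_apply_le_norm u i).trans hu)
  rw [clip_apply, min_eq_right h.2, max_eq_right h.1]

theorem norm_clip_sub_clip_le (u v : LInf) : ‖clip u - clip v‖ ≤ ‖u - v‖ := by
  refine norm_le_of_forall_abs_le (norm_nonneg _) fun i => ?_
  refine le_trans ?_ (abs_apply_le_norm (u - v) i)
  rw [lp.coeFn_sub, lp.coeFn_sub, Pi.sub_apply, Pi.sub_apply, clip_apply, clip_apply]
  refine (abs_max_sub_max_le_max _ _ _ _).trans ?_
  rw [sub_self, abs_zero, max_eq_right (abs_nonneg _)]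
  refine (abs_min_sub_min_le_max _ _ _ _).trans ?_
  rw [sub_self, abs_zero, max_eq_right (abs_nonneg _)]

theorem field_apply (a d : ℝ) (u : LInf) (i : ℤ) :
    field a d u i = d * (u (i - 1) - 2 * u i + u (i + 1)) + g a (u i) := rfl

theorem field_sub_field_apply (a d : ℝ) (u v : LInf) (i : ℤ) :
    field a d u i - field a d v i = d * ((u - v) (i - 1) - 2 * (u - v) i + (u - v) (i + 1))
      + secantSlope a (u i) (v i) * (u - v) i := by
  rw [field_apply, field_apply, lp.coeFn_sub]
  simp only [Pi.sub_apply]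
  linear_combination g_sub_g a (u i) (v i)

theorem abs_secantSlope_le {a u v : ℝ} (ha : a ∈ Ioo (0 : ℝ) 1) (hu : |u| ≤ 4) (hv : |v| ≤ 4) :
    |secantSlope a u v| ≤ 65 := by
  obtain ⟨h0, h1⟩ := ha
  have hu' := abs_le.1 hu
  have hv' := abs_le.1 hv
  -- The three terms are bounded by `48`, `16` and `1`.
  rw [secantSlope, abs_le]
  constructor
  · nlinarith [sq_nonneg (u - v)]
  · nlinarith [sq_nonneg (u + v), sq_nonneg u, sq_nonneg v]

theorem norm_field_sub_field_le {a d : ℝ} (ha : a ∈ Ioo (0 : ℝ) 1) (hd : 0 ≤ d) {u v : LInf}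
    (hu : ‖u‖ ≤ 4) (hv : ‖v‖ ≤ 4) :
    ‖field a d u - field a d v‖ ≤ (4 * d + 65) * ‖u - v‖ := by
  refine norm_le_of_forall_abs_le (by positivity) fun i => ?_
  rw [lp.coeFn_sub, Pi.sub_apply, field_sub_field_apply]
  have h := abs_apply_le_norm (u - v)
  have h1 := abs_le.1 (h (i - 1))
  have h2 := abs_le.1 (h i)
  have h3 := abs_le.1 (h (i + 1))
  have h4 : |(u - v) (i - 1) - 2 * (u - v) i + (u - v) (i + 1)| ≤ 4 * ‖u - v‖ :=
    abs_le.2 ⟨by linarith, by linarith⟩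
  have h5 := abs_secantSlope_le ha ((abs_apply_le_norm u i).trans hu)
    ((abs_apply_le_norm v i).trans hv)
  refine (abs_add_le _ _).trans ?_
  rw [abs_mul, abs_mul, abs_of_nonneg hd]
  calc d * |(u - v) (i - 1) - 2 * (u - v) i + (u - v) (i + 1)|
        + |secantSlope a (u i) (v i)| * |(u - v) i|
      ≤ d * (4 * ‖u - v‖) + 65 * ‖u - v‖ := by
        gcongr
        exact h i
    _ = _ := by ring

/-- The cubic field is only locally Lipschitz; after clipping it is globally Lipschitz and bounded,
and it is unchanged on the ball of radius `4`. -/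
theorem exists_isForwardSolution_field_clip {a d : ℝ} (ha : a ∈ Ioo (0 : ℝ) 1) (hd : 0 ≤ d)
    (x₀ : LInf) : ∃ u, IsForwardSolution (fun y => field a d (clip y)) u ∧ u 0 = x₀ := by
  have hlip : LipschitzWith (Real.toNNReal (4 * d + 65)) (fun y => field a d (clip y)) := by
    refine LipschitzWith.of_dist_le_mul fun u v => ?_
    rw [Real.coe_toNNReal _ (by positivity), dist_eq_norm, dist_eq_norm]
    refine (norm_field_sub_field_le ha hd (norm_clip_le u) (norm_clip_le v)).trans ?_
    gcongr
    exact norm_clip_sub_clip_le u v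
  refine exists_isForwardSolution_of_lipschitzWith hlip (M := Real.toNNReal ((4 * d + 65) * 4))
    (fun u => ?_) x₀
  rw [Real.coe_toNNReal _ (by positivity)]
  have h := norm_field_sub_field_le (u := clip u) (v := 0) ha hd (norm_clip_le u) (by simp)
  have h0 : field a d 0 = 0 := by
    ext i
    simp [field_apply, g]
  rw [h0, sub_zero, sub_zero] at h
  refine h.trans ?_
  gcongr
  exact norm_clip_le u

end Nagumo

/-! ### Stability for words in `{0, 1}`, instability when the letter `a` occurs. -/

namespace Nagumo

open Set Filter Topology

theorem secantSlope_le_of_near {a s u v : ℝ} (ha : a ∈ Ioo (0 : ℝ) 1)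
    (hs : s = 0 ∨ s = 1) (hu : |u - s| ≤ 2 * radius a) (hv : |v - s| ≤ 2 * radius a) :
    secantSlope a u v ≤ -(96 * radius a) := by
  have hz : s ∈ zeros a := by rcases hs with rfl | rfl <;> simp [zeros]
  have h := (abs_le.1 (abs_secantSlope_sub_le ha hz hu hv)).2
  have hr := radius_mul_le ha
  have hσ : secantSlope a s s ≤ -(128 * radius a) := by
    rcases hs with rfl | rfl <;> simp only [secantSlope] <;> linarith
  linarith

theorem le_secantSlope_of_near {a u v : ℝ} (ha : a ∈ Ioo (0 : ℝ) 1)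
    (hu : |u - a| ≤ 2 * radius a) (hv : |v - a| ≤ 2 * radius a) :
    96 * radius a ≤ secantSlope a u v := by
  have h := (abs_le.1 (abs_secantSlope_sub_le ha (by simp [zeros]) hu hv)).1
  have hσ : secantSlope a a a = 128 * radius a := by
    simp only [secantSlope, radius]; ring
  linarith

theorem abs_sub_le_two_mul_radius {a : ℝ} {s : ℤ → ℝ} {x y : LInf}
    (hxs : ∀ i, |x i - s i| ≤ radius a) (hy : ‖y - x‖ ≤ radius a) (i : ℤ) :
    |y i - s i| ≤ 2 * radius a := by
  have h1 := (abs_apply_le_norm (y - x) i).trans hy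
  rw [lp.coeFn_sub, Pi.sub_apply] at h1
  have h2 := abs_sub_le (y i) (x i) (s i)
  have h3 := hxs i
  linarith

theorem field_apply_of_stationary {a d : ℝ} {x : LInf} (hstat : field a d x = 0) (y : LInf)
    (i : ℤ) :
    field a d y i = d * ((y - x) (i - 1) - 2 * (y - x) i + (y - x) (i + 1))
      + secantSlope a (y i) (x i) * (y - x) i := by
  have := field_sub_field_apply a d y x i
  rwa [hstat, lp.coeFn_zero, Pi.zero_apply, sub_zero] at this

section

variable {a d : ℝ} {n : ℕ} {s : ℤ → ℝ} {x : LInf} (ha : a ∈ Ioo (0 : ℝ) 1)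
  (hs : s ∈ periodicWords (zeros a) n) (hxs : ∀ i, |x i - s i| ≤ radius a)
include ha hs hxs

theorem norm_le_two_of_near : ‖x‖ ≤ 2 := by
  refine norm_le_of_forall_abs_le (by norm_num) fun i => ?_
  have h1 := abs_le.1 (hxs i)
  obtain ⟨h2, h3⟩ := mem_Icc_of_mem_zeros ha (hs.1 i)
  have h4 := radius_le_one ha
  exact abs_le.2 ⟨by linarith, by linarith⟩

theorem norm_le_four_of_near {y : LInf} (hy : ‖y - x‖ ≤ radius a) : ‖y‖ ≤ 4 := by
  have h1 := norm_le_two_of_near ha hs hxs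
  have h2 := radius_le_one ha
  have h3 := norm_le_norm_add_norm_sub' y x
  linarith

variable (hd : 0 < d)
include hd

/-- For a small step, the new deviation at a site is a combination of the old deviations there and
at its neighbours, with nonnegative weights. The diffusion cancels in their sum `1 + h * S`, and `S`
is negative. -/
theorem contracting_step_field (hstat : field a d x = 0) (hst : ∀ i, s i = 0 ∨ s i = 1) {y : LInf}
    (hy : ‖y - x‖ ≤ radius a) :
    ∃ h₀ > 0, ∀ h, 0 < h → h < h₀ →
      ‖y - x + h • field a d y‖ ≤ (1 - h * radius a) * ‖y - x‖ := by
  have hr := radius_pos ha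
  have hr1 := radius_le_one ha
  -- As `S ≥ -65`, this threshold keeps the central weight `1 + h * (S - 2 * d)` nonnegative.
  refine ⟨1 / (65 + 2 * d), by positivity, fun h h0 h1 => ?_⟩
  rw [lt_div_iff₀ (by positivity)] at h1
  refine norm_le_of_forall_abs_le (mul_nonneg (by nlinarith) (norm_nonneg _)) fun i => ?_
  rw [lp.coeFn_add, lp.coeFn_smul, Pi.add_apply, Pi.smul_apply, smul_eq_mul,
    field_apply_of_stationary hstat]
  have hS := secantSlope_le_of_near ha (hst i) (abs_sub_le_two_mul_radius hxs hy i)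
    ((hxs i).trans (by linarith))
  have hS' := (abs_le.1 (abs_secantSlope_le ha
    ((abs_apply_le_norm y i).trans (norm_le_four_of_near ha hs hxs hy))
    ((abs_apply_le_norm x i).trans ((norm_le_two_of_near ha hs hxs).trans (by norm_num))))).1
  set S := secantSlope a (y i) (x i)
  set w := y - x
  have hw := abs_apply_le_norm w
  have hcoef : 0 ≤ 1 + h * (S - 2 * d) := by nlinarith
  have hhd : 0 ≤ h * d := by positivity
  calc |w i + h * (d * (w (i - 1) - 2 * w i + w (i + 1)) + S * w i)|
      = |(1 + h * (S - 2 * d)) * w i + h * d * (w (i - 1) + w (i + 1))| := by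
        congr 1; ring
    _ ≤ (1 + h * (S - 2 * d)) * |w i| + h * d * (|w (i - 1)| + |w (i + 1)|) := by
        refine (abs_add_le _ _).trans ?_
        rw [abs_mul, abs_mul, abs_of_nonneg hcoef, abs_of_nonneg hhd]
        gcongr
        exact abs_add_le _ _
    _ ≤ (1 + h * (S - 2 * d)) * ‖w‖ + h * d * (‖w‖ + ‖w‖) := by
        gcongr <;> exact hw _
    _ = (1 + h * S) * ‖w‖ := by ring
    _ ≤ (1 - h * radius a) * ‖w‖ := by
        gcongr
        nlinarith

/-- Existence comes from the clipped equation: the decay estimate keeps its solution near `x`, where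
clipping does nothing. -/
theorem isAsymptoticallyStable_field (hstat : field a d x = 0) (hst : ∀ i, s i = 0 ∨ s i = 1) :
    IsAsymptoticallyStable (field a d) x := by
  have hr := radius_pos ha
  refine isAsymptoticallyStable_of_contracting_step hr hr
    (fun y hy => contracting_step_field ha hs hxs hd hstat hst hy) fun x₀ hx₀ => ?_
  obtain ⟨u, hu, rfl⟩ := exists_isForwardSolution_field_clip ha hd.le x₀
  refine ⟨u, fun t ht => ?_, rfl⟩
  have h1 : ‖u t - x‖ ≤ radius a := by
    refine (norm_sub_le_exp_of_contracting_step (F := fun y => field a d (clip y)) hr (r := radius a)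
      (fun y hy => ?_) hr le_rfl hu hx₀.le ht).trans ?_
    · simp only [clip_eq_self (norm_le_four_of_near ha hs hxs hy)]
      exact contracting_step_field ha hs hxs hd hstat hst hy
    · have hle : Real.exp (-(radius a / 2) * t) ≤ 1 := Real.exp_le_one_iff.2 (by nlinarith)
      nlinarith
  have h2 := hu t ht
  simp only [clip_eq_self (norm_le_four_of_near ha hs hxs h1)] at h2
  exact h2

/-- Comparison principle via the norm: for `|w| ≤ 1`, the one-sided bound `w ≥ 0` is the same as `‖1
- w‖ ≤ 1`. The barrier `1 + β * exp (66 * t)` controls `‖1 - w‖`, and then `β` tends to `0`. -/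
theorem le_of_isForwardSolution_of_le (hstat : field a d x = 0) {u : ℝ → LInf}
    (hu : IsForwardSolution (field a d) u) (hclose : ∀ t, 0 ≤ t → ‖u t - x‖ ≤ radius a)
    (h0 : ∀ i, x i ≤ u 0 i) {t : ℝ} (ht : 0 ≤ t) (i : ℤ) : x i ≤ u t i := by
  have hr := radius_pos ha
  have hr1 := radius_le_one ha
  have hone : ∀ i, (1 : LInf) i = 1 := fun i => by rw [lp.infty_coeFn_one]; rfl
  have key : ∀ β : ℝ, 0 < β → ‖1 - (u t - x)‖ ≤ 1 + β * Real.exp (66 * t) := by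
    intro β hβ
    refine norm_le_of_euler_step (w := fun t => 1 - (u t - x)) (w' := fun t => -field a d (u t))
      (b := fun t => 1 + β * Real.exp (66 * t))
      (b' := fun t => β * (Real.exp (66 * t) * 66))
      (fun t ht => ((hu t ht).sub_const x).const_sub 1) ?_ (fun t => ?_) (fun t ht he => ?_) ht
    · refine norm_le_of_forall_abs_le (by positivity) fun i => ?_
      rw [lp.coeFn_sub, lp.coeFn_sub, Pi.sub_apply, Pi.sub_apply, hone]
      have h1 := abs_le.1 ((abs_apply_le_norm (u 0 - x) i).trans (hclose 0 le_rfl))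
      rw [lp.coeFn_sub, Pi.sub_apply] at h1
      have h2 := h0 i
      have h3 := Real.exp_pos (66 * 0)
      exact abs_le.2 ⟨by nlinarith, by nlinarith⟩
    · have : HasDerivAt (fun t : ℝ => 66 * t) 66 t := by
        simpa using (hasDerivAt_id t).const_mul (66 : ℝ)
      exact (this.exp.const_mul β).const_add 1
    · set B := β * Real.exp (66 * t) with hB
      have hBpos : 0 < B := by positivity
      -- On contact `w ≥ -B`, and the slope bound `65` lets this defect grow at rate at most `65 *
      -- B`, below the barrier's `66 * B`.
      refine ⟨65 * B, by nlinarith, 1 / (65 + 4 * d), by positivity,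
        fun h hh0 hh1 => ?_⟩
      rw [lt_div_iff₀ (by positivity)] at hh1
      rw [he]
      refine norm_le_of_forall_abs_le (by positivity) fun i => ?_
      rw [lp.coeFn_add, lp.coeFn_smul, lp.coeFn_neg, lp.coeFn_sub, Pi.add_apply, Pi.smul_apply,
        smul_eq_mul, Pi.neg_apply, Pi.sub_apply, hone,
        field_apply_of_stationary hstat]
      have hy := hclose t ht
      have hS := abs_le.1 (abs_secantSlope_le ha
        ((abs_apply_le_norm (u t) i).trans (norm_le_four_of_near ha hs hxs hy))
        ((abs_apply_le_norm x i).trans ((norm_le_two_of_near ha hs hxs).trans (by norm_num))))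
      set S := secantSlope a (u t i) (x i)
      set w := u t - x with hw
      have hlow : ∀ k, -B ≤ w k := fun k => by
        have := (abs_le.1 ((abs_apply_le_norm (1 - w) k).trans he.le)).2
        rw [lp.coeFn_sub, Pi.sub_apply, hone] at this
        linarith
      have hup : ∀ k, w k ≤ 1 := fun k =>
        (abs_le.1 (abs_apply_le_norm w k)).2.trans (hy.trans hr1)
      have hcoef : 0 ≤ 1 + h * (S - 2 * d) := by nlinarith
      have hhd : 0 ≤ h * d := by positivity
      have e : 1 - w i + h * -(d * (w (i - 1) - 2 * w i + w (i + 1)) + S * w i)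
          = 1 - ((1 + h * (S - 2 * d)) * w i + h * d * (w (i - 1) + w (i + 1))) := by ring
      rw [e, abs_le]
      have l1 := mul_le_mul_of_nonneg_left (hlow i) hcoef
      have l2 := mul_le_mul_of_nonneg_left (add_le_add (hlow (i - 1)) (hlow (i + 1))) hhd
      have l3 := mul_le_mul_of_nonneg_left (hup i) hcoef
      have l4 := mul_le_mul_of_nonneg_left (add_le_add (hup (i - 1)) (hup (i + 1))) hhd
      have l5 : h * S ≤ h * 65 := by gcongr; exact hS.2
      have l6 : h * S * B ≤ h * 65 * B := by gcongr
      constructor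
      · nlinarith [mul_pos hh0 hBpos]
      · nlinarith
  have hle : ‖1 - (u t - x)‖ ≤ 1 := by
    refine le_of_forall_pos_le_add fun ε hε => ?_
    have := key (ε / Real.exp (66 * t)) (by positivity)
    rwa [div_mul_cancel₀ _ (Real.exp_pos _).ne'] at this
  have := (abs_le.1 ((abs_apply_le_norm (1 - (u t - x)) i).trans hle)).2
  rw [lp.coeFn_sub, lp.coeFn_sub, Pi.sub_apply, Pi.sub_apply, hone] at this
  linarith

/-- Lyapunov stability would keep the solution from `x + η` near `x`, and comparison keeps it above
`x`. At the site `j` the slope is at least `96 * radius a > 2 * d`, so the coordinate is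
nondecreasing and stays `η` above `x j`, contrary to attraction. -/
theorem not_isAsymptoticallyStable_field (hd' : 2 * d ≤ radius a ^ 3) (hstat : field a d x = 0)
    {j : ℤ} (hj : s j = a) : ¬ IsAsymptoticallyStable (field a d) x := by
  rintro ⟨hlyap, γ, hγ, hattr⟩
  have hr := radius_pos ha
  have hone : ∀ i, (1 : LInf) i = 1 := fun i => by rw [lp.infty_coeFn_one]; rfl
  obtain ⟨δ, hδ, hlyap⟩ := hlyap (radius a) hr
  set η := min δ γ / 2 with hη
  have hηpos : 0 < η := by positivity
  have hx₀ : ‖x + η • (1 : LInf) - x‖ ≤ η := by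
    rw [add_sub_cancel_left]
    refine norm_le_of_forall_abs_le hηpos.le fun i => ?_
    rw [lp.coeFn_smul, Pi.smul_apply, hone, smul_eq_mul, mul_one, abs_of_pos hηpos]
  have hm1 := min_le_left δ γ
  have hm2 := min_le_right δ γ
  obtain ⟨⟨u, hu, hu0⟩, hstay⟩ := hlyap _ (hx₀.trans_lt (by linarith))
  have hclose : ∀ t, 0 ≤ t → ‖u t - x‖ ≤ radius a := fun t ht => (hstay u hu hu0 t ht).le
  have htend := (hattr _ (hx₀.trans_lt (by linarith))).2 u hu hu0
  have hu0' : ∀ i, u 0 i = x i + η := fun i => by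
    rw [hu0, lp.coeFn_add, Pi.add_apply, lp.coeFn_smul, Pi.smul_apply, hone, smul_eq_mul, mul_one]
  have hpos : ∀ t, 0 ≤ t → ∀ i, x i ≤ u t i := fun t ht i =>
    le_of_isForwardSolution_of_le ha hs hxs hd hstat hu hclose
      (fun i => by rw [hu0']; linarith) ht i
  have hder : ∀ t, 0 ≤ t → HasDerivWithinAt (fun t => u t j) (field a d (u t) j) (Ici 0) t :=
    fun t ht => (lp.evalCLM ℝ (fun _ : ℤ => ℝ) ∞ j).hasFDerivAt.comp_hasDerivWithinAt t (hu t ht)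
  have hmono : MonotoneOn (fun t => u t j) (Ici 0) := by
    refine monotoneOn_of_hasDerivWithinAt_nonneg (convex_Ici 0)
      (fun t ht => (hder t ht).continuousWithinAt)
      (fun t ht => (hder t (interior_subset ht)).mono interior_subset) fun t ht => ?_
    have ht0 : 0 ≤ t := interior_subset ht
    rw [field_apply_of_stationary hstat]
    have hu2 := abs_sub_le_two_mul_radius hxs (hclose t ht0) j
    have hx2 := hxs j
    rw [hj] at hu2 hx2
    have hS := le_secantSlope_of_near ha hu2 (hx2.trans (by linarith))
    have hw : ∀ i, 0 ≤ (u t - x) i := fun i => by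
      rw [lp.coeFn_sub, Pi.sub_apply]
      linarith [hpos t ht0 i]
    have hdr := le_eight_mul_radius ha hd'
    have h1 := hw j
    have h2 := mul_nonneg hd.le (hw (j - 1))
    have h3 := mul_nonneg hd.le (hw (j + 1))
    nlinarith
  obtain ⟨t, ht, ht0⟩ := ((tendsto_iff_norm_sub_tendsto_zero.1 htend).eventually_lt_const
    hηpos |>.and (eventually_ge_atTop 0)).exists
  have h1 := hmono (mem_Ici.2 le_rfl) (mem_Ici.2 ht0) ht0
  simp only [hu0'] at h1
  have h2 := (abs_le.1 (abs_apply_le_norm (u t - x) j)).2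
  rw [lp.coeFn_sub, Pi.sub_apply] at h2
  linarith

end

end Nagumo

/-! ### The equivariant bijection between words and stationary solutions. -/

namespace Nagumo

theorem translate_mem_periodicStationary {n : ℕ} {a d : ℝ} {u : ℤ → ℝ}
    (hu : u ∈ periodicStationary n a d) (l : ℤ) : translate l u ∈ periodicStationary n a d := by
  refine ⟨fun i => ?_, fun i => ?_⟩
  · have h := hu.1 (i + l)
    simp only [rhs, translate] at h ⊢
    rwa [show i - 1 + l = i + l - 1 by ring, show i + 1 + l = i + l + 1 by ring]
  · simp only [translate]
    rw [← hu.2 (i + l)]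
    congr 1; ring

theorem reflect_mem_periodicStationary {n : ℕ} {a d : ℝ} {u : ℤ → ℝ}
    (hu : u ∈ periodicStationary n a d) : reflect u ∈ periodicStationary n a d := by
  refine ⟨fun i => ?_, fun i => ?_⟩
  · have h := hu.1 (1 - i)
    simp only [rhs, reflect] at h ⊢
    rw [show (1 : ℤ) - (i - 1) = 1 - i + 1 by ring, show (1 : ℤ) - (i + 1) = 1 - i - 1 by ring]
    linarith
  · simp only [reflect]
    rw [← hu.2 (1 - (i + n))]
    congr 1; ring

theorem periodicWords_mono {A A' : Finset ℝ} (h : A ⊆ A') (n : ℕ) :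
    periodicWords A n ⊆ periodicWords A' n := fun _ hu => ⟨fun i => h (hu.1 i), hu.2⟩

theorem field_eq_zero_of_stationary {n : ℕ} {a d : ℝ} {u : ℤ → ℝ}
    (hu : u ∈ periodicStationary n a d) {x : LInf} (hx : ∀ i, x i = u i) : field a d x = 0 := by
  ext i
  rw [field_apply, hx, hx, hx]
  exact hu.1 i

theorem hasWordCounts_stationary {n : ℕ} (hn : n ≠ 0) {a d : ℝ} (ha : a ∈ Set.Ioo (0 : ℝ) 1)
    (hd : 0 < d) (hd' : 2 * d ≤ radius a ^ 3) :
    HasWordCounts 3 n (periodicStationary n a d)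
      ∧ HasWordCounts 2 n (stablePeriodicStationary n a d) := by
  choose! e hes hen using
    fun s (hs : s ∈ periodicWords (zeros a) n) => exists_stationary_near ha hn hd hd' hs
  have hinj : Set.InjOn e (periodicWords (zeros a) n) := fun s hs t ht h =>
    word_unique ha hs ht (hen s hs) (by rw [h]; exact hen t ht)
  have hsurj : ∀ u ∈ periodicStationary n a d, ∃ s ∈ periodicWords (zeros a) n, e s = u := by
    intro u hu
    obtain ⟨s, hs, hus⟩ := exists_word_near ha hn hd hd' hu
    exact ⟨s, hs, stationary_unique ha hn hd hd' hs (hes s hs) hu (hen s hs) hus⟩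
  -- Both sides are stationary and close to the same translated word, so uniqueness identifies them;
  -- reflections are treated alike.
  have ht : ∀ s ∈ periodicWords (zeros a) n, ∀ l, e (translate l s) = translate l (e s) :=
    fun s hs l =>
      have hs' := translate_mem_periodicWords hs l
      stationary_unique ha hn hd hd' hs' (hes _ hs')
        (translate_mem_periodicStationary (hes s hs) l) (hen _ hs') fun i => hen s hs (i + l)
  have hr : ∀ s ∈ periodicWords (zeros a) n, e (reflect s) = reflect (e s) :=
    fun s hs =>
      have hs' := reflect_mem_periodicWords hs
      stationary_unique ha hn hd hd' hs' (hes _ hs')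
        (reflect_mem_periodicStationary (hes s hs)) (hen _ hs') fun i => hen s hs (1 - i)
  have hsub : periodicWords {0, 1} n ⊆ periodicWords (zeros a) n :=
    periodicWords_mono (by intro s; simp [zeros]; tauto) n
  refine ⟨card_zeros ha ▸ HasWordCounts.of_equivariant hn ⟨hes, hinj, hsurj⟩ ht hr, ?_⟩
  -- The same map `e`, restricted to words over `{0, 1}`, has exactly the stable solutions as its
  -- image.
  rw [show 2 = ({0, 1} : Finset ℝ).card by simp]
  refine HasWordCounts.of_equivariant hn ⟨fun s hs => ?_, hinj.mono hsub, ?_⟩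
    (fun s hs => ht s (hsub hs)) fun s hs => hr s (hsub hs)
  · have hs' := hsub hs
    have hmem : Memℓp (E := fun _ : ℤ => ℝ) (e s) ∞ := memℓp_infty ⟨1, by
      rintro _ ⟨i, rfl⟩
      obtain ⟨h0, h1⟩ := mem_Icc_of_periodicStationary ha hn hd (hes s hs') i
      exact abs_le.2 ⟨by linarith, h1⟩⟩
    exact ⟨hes s hs', ⟨e s, hmem⟩, fun i => rfl, isAsymptoticallyStable_field ha hs' (hen s hs') hd
      (field_eq_zero_of_stationary (hes s hs') fun i => rfl)
      fun i => by simpa using hs.1 i⟩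
  · rintro u ⟨hu, x, hx, hstab⟩
    obtain ⟨s, hs, rfl⟩ := hsurj u hu
    refine ⟨s, ⟨fun i => ?_, hs.2⟩, rfl⟩
    have hne : s i ≠ a := fun hi => not_isAsymptoticallyStable_field ha hs
      (fun i => by rw [hx]; exact hen s hs i) hd hd' (field_eq_zero_of_stationary hu hx) hi hstab
    have := hs.1 i
    simp only [zeros, Finset.mem_insert, Finset.mem_singleton] at this ⊢
    tauto

end Nagumo

theorem theorem1 (n : ℕ) (hn : 2 ≤ n) (a : ℝ) (ha : a ∈ Set.Ioo (0 : ℝ) 1) :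
    ∃ d₀ : ℝ, 0 < d₀ ∧ ∀ d : ℝ, 0 < d → d < d₀ →
      ((Nagumo.periodicStationary n a d).Finite ∧
        (Nagumo.periodicStationary n a d).ncard = 3 ^ n ∧
        ((Nagumo.classes Nagumo.translationSetoid
          (Nagumo.periodicStationary n a d)).ncard : ℚ) = Nagumo.N 3 n ∧
        ((Nagumo.classes Nagumo.translationSetoid
          (Nagumo.primitivePart n (Nagumo.periodicStationary n a d))).ncard : ℚ)
            = Nagumo.L 3 n ∧
        ((Nagumo.classes Nagumo.translationReflectionSetoid
          (Nagumo.periodicStationary n a d)).ncard : ℚ) = Nagumo.B 3 n ∧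
        ((Nagumo.classes Nagumo.translationReflectionSetoid
          (Nagumo.primitivePart n (Nagumo.periodicStationary n a d))).ncard : ℚ)
            = Nagumo.BL 3 n) ∧
      ((Nagumo.stablePeriodicStationary n a d).ncard = 2 ^ n ∧
        ((Nagumo.classes Nagumo.translationSetoid
          (Nagumo.stablePeriodicStationary n a d)).ncard : ℚ) = Nagumo.N 2 n ∧
        ((Nagumo.classes Nagumo.translationSetoid
          (Nagumo.primitivePart n (Nagumo.stablePeriodicStationary n a d))).ncard : ℚ)
            = Nagumo.L 2 n ∧
        ((Nagumo.classes Nagumo.translationReflectionSetoid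
          (Nagumo.stablePeriodicStationary n a d)).ncard : ℚ) = Nagumo.B 2 n ∧
        ((Nagumo.classes Nagumo.translationReflectionSetoid
          (Nagumo.primitivePart n (Nagumo.stablePeriodicStationary n a d))).ncard : ℚ)
            = Nagumo.BL 2 n) := by
  have hn0 : n ≠ 0 := by omega
  have hr := Nagumo.radius_pos ha
  -- The threshold encodes `2 * d ≤ radius a ^ 3` and depends on `a` alone, not on `n`.
  refine ⟨Nagumo.radius a ^ 3 / 2, by positivity, fun d hd hd' => ?_⟩
  obtain ⟨h3, h2⟩ := Nagumo.hasWordCounts_stationary hn0 ha hd (by linarith)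
  exact ⟨⟨h3.finite, h3.ncard, h3.translation, h3.translation_primitive, h3.reflection,
    h3.reflection_primitive⟩, h2.ncard, h2.translation, h2.translation_primitive, h2.reflection,
    h2.reflection_primitive⟩
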